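/- **Setting.** A track is a natural number, an argument track is a track $\ge 2$, positions are elements of $\mathbb N^*$ (finite sequences of tracks), $|a|$ is the length of $a$, $\mathrm{ad}(a)$ is the number of argument tracks in $a$, and the collapse $\overline a$ is $a$ with every argument track replaced by $2$. *Terms.* $\Lambda^{001}$ is the set of possibly infinite $\lambda$-terms $t ::= x \mid \lambda x.t \mid t\,u$ (coinductive grammar, up to $\alpha$-equivalence), seen as labelled trees ($\lambda x.t$ has its body at $0$; $t\,u$ has $t$ at $1$ and $u$ at $2$), in which every infinite branch contains infinitely many $2$'s. Write $t\xrightarrow{b}t'$ if $t|_b=(\lambda x.r)s$ and $t'$ is $t$ with this subterm replaced by $r[s/x]$. A sequence $t=t_0\xrightarrow{b_0}t_1\xrightarrow{b_1}\cdots$ of $001$-terms of length $\le\omega$ is strongly converging if it is finite or $\mathrm{ad}(b_n)\to\infty$; its limit $t'$ is its last term if it is finite, and otherwise the labelled tree with $t'(b)=t_n(b)$ for all large $n$. *Types.* Types $T$ and sequence types $F$ are given coinductively by $T ::= \alpha \mid F\to T$ and $F ::= (T_k)_{k\in K}$ with $K\subseteq\mathbb N\setminus\{0,1\}$; $K=\mathrm{Rt}(F)$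 is the set of roots of $F$, and $k\cdot T$ is the sequence type with the single entry $T$ on track $k$. They are labelled trees ($F\to T$ has $T$ at $1$ and $T_k$ at $k$), equality is syntactic, and no infinite branch may end by $1^\omega$. Sequence types are disjoint if their sets of roots are; their join is then the union. A context maps variables to sequence types; joins of contexts are pointwise. *Derivations.* A derivation is a (possibly infinite) tree of judgments $C\vdash t:T$ with $t\in\Lambda^{001}$, all of whose nodes are correct for one of the rules: (ax) $x:k\cdot T\vdash x:T$ with $k\ge2$; (abs) from $C\vdash t:T$ (at $0$) infer $C-x\vdash\lambda x.t:C(x)\to T$; (app) from $C\vdash t:(S_k)_{k\in K}\to T$ (at $1$) and $D_k\vdash u:S_k$ (at $k$), for all $k\in K$, infer $C\cup\bigcup_{k\in K}D_k\vdash t\,u:T$, where the contexts must be disjoint. If $P$ is a derivation of $C\vdash t:T$, its node at $a\in\mathrm{supp}(P)$ is written $C(a)\vdash t|_{\overline a}:T(a)$. The axiom track of an axiom leaf $a$ is $\mathrm{tr}(a)$. $P$ is quantitative if for all $a\in\mathrm{supp}(P)$ and every variable $x$, $C(a)(x)=\bigcup_{a'}\mathrm{tr}(a')\cdot T(a')$,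 where $a'$ ranges over the axiom leaves at or above $a$ that type an occurrence of $x$ which is free in $t|_{\overline a}$. *Approximability.* The bisupport of $P$ is the set of the right bipositions $(a,c)$, $c\in\mathrm{supp}(T(a))$, and of the left bipositions $(a,x,c)$, $c\in\mathrm{supp}(C(a)(x))$; $P$ assigns a type symbol to each. A finite approximation of $P$ is a derivation typing the same term, with finite bisupport included in that of $P$, and with the same symbols as $P$ there. $P$ is approximable if every finite subset of its bisupport is contained in the bisupport of some finite approximation of $P$. *Reduction of derivations.* Let $P$ be a quantitative derivation typing $t$, and let $t\xrightarrow{b}t'$ with $t|_b=(\lambda x.r)s$. For $a\in\mathrm{supp}(P)$ with $\overline a=b$ and $k\in\mathrm{Rt}(C(a\cdot1\cdot0)(x))$ let $a\cdot1\cdot0\cdot a_k$ be the axiom leaf with axiom track $k$ that types this $x$. The residual of a position is: $a\cdot k\cdot\alpha_0\mapsto a\cdot a_k\cdot\alpha_0$ ($k\ge2$); $a\cdot1\cdot0\cdot\alpha_0\mapsto a\cdot\alpha_0$ if $\alpha_0$ is none of the $a_k$; $\alpha\mapsto\alpha$ if $b$ is not a prefix of $\overline\alpha$; the other positions have none. The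 reduct $P'$ of $P$ has as support the set of all residuals, and if $\alpha'$ is the residual of $\alpha$, its node at $\alpha'$ is $C'(\alpha')\vdash t'|_{\overline{\alpha'}}:T(\alpha)$. Here $C'(\alpha')=(C(\alpha)-x)\cup\bigcup_{k\in\mathrm{Rt}(C(\alpha)(x))}C(a\cdot k)$ in the second case, and $C'(\alpha')=C(\alpha)$ in the other two. **Statement.** Let $t=t_0\xrightarrow{b_0}t_1\xrightarrow{b_1}\cdots$ be a strongly converging reduction sequence of $001$-terms with limit $t'$, and let $P$ be a quantitative derivation of $C\vdash t:T$. Let $P_0=P$ and let $P_{n+1}$ be the reduct of $P_n$ for $t_n\xrightarrow{b_n}t_{n+1}$ (a finite sequence is continued constantly). Then: 1. Each $P_n$ is a derivation of $C\vdash t_n:T$. 2. For each position $a$ and each $N$ such that $|b_n|>|a|$ for all reduction steps $n\ge N$: either $a\notin\mathrm{supp}(P_n)$ for all $n\ge N$, or $a\in\mathrm{supp}(P_n)$ for all $n\ge N$, with a context $C_n(a)$ and a type $T_n(a)$ that do not depend on $n\ge N$. So the $P_n$ have a limit labelled tree $P'$: its support is the set of the $a$ that are in $\mathrm{supp}(P_n)$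 for all large $n$, and its node at $a$ is $C_n(a)\vdash t'|_{\overline a}:T_n(a)$ for large $n$. 3. $P'$ is a derivation of $C\vdash t':T$. 4. If $P$ is approximable, then $P'$ is approximable. -/

import Mathlib

noncomputable section

namespace RigidTyping

/-! ### Positions and labelled trees -/

/-- Finite sequences of tracks (natural numbers), read from the root. -/
abbrev Pos := List ℕ

/-- Applicative depth: the number of argument tracks (tracks at least `2`). -/
def appDepth (a : Pos) : ℕ := a.countP (fun k => decide (2 ≤ k))

/-- The collapse of a position: every argument track becomes `2`. -/
def collapse (a : Pos) : Pos := a.map (fun k => min k 2)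

/-- The number of abstractions crossed along a position of a term or of a derivation
(track `0` leads into the body of an abstraction, and only there). -/
def binders (a : Pos) : ℕ := a.count 0

/-- A partial labelling of positions; `none` means that the position is not in the support. -/
abbrev LTree (L : Type) := Pos → Option L

/-- The part of a labelled tree above the position `a`. -/
def sub {L : Type} (t : LTree L) (a : Pos) : LTree L := fun p => t (a ++ p)

/-- The empty labelling. -/
def emptyTree {L : Type} : LTree L := fun _ => none

open Classical in
/-- Some value that satisfies `p`, if there is one. -/
def pick {L : Type} (p : L → Prop) : Option L :=
  if h : ∃ v, p v then some h.choose else none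

/-! ### Infinitary terms, modulo renaming of bound variables -/

/-- Labels of terms. Variables are de Bruijn indices: an index that points beyond all the
enclosing abstractions is a free variable. -/
inductive TmLabel where
  | var (i : ℕ)
  | lam
  | app
  deriving DecidableEq

abbrev Tm := LTree TmLabel

/-- The labelled trees that are the parsing tree of a term of `Λ¹¹¹`: a variable has no child,
an abstraction has the child `0` only, an application has the children `1` and `2` only. -/
def IsTerm (t : Tm) : Prop :=
  (t []).isSome ∧
  ∀ p k, (t (p ++ [k])).isSome ↔
    (k = 0 ∧ t p = some .lam) ∨ ((k = 1 ∨ k = 2) ∧ t p = some .app)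

/-- The terms of `Λ⁰⁰¹`: every infinite branch has infinitely many argument tracks. -/
def IsTerm001 (t : Tm) : Prop :=
  IsTerm t ∧
  ∀ f : ℕ → ℕ, (∀ n, (t ((List.range n).map f)).isSome) → {i | 2 ≤ f i}.Infinite

/-- Add `d` to the indices that are at least `c`. -/
def liftLabel (d c : ℕ) : TmLabel → TmLabel
  | .var i => .var (if i < c then i else i + d)
  | l => l

/-- Add `d` to all the free indices of a term. -/
def lift (d : ℕ) (s : Tm) : Tm := fun p => (s p).map (liftLabel d (binders p))

/-- `subst d r s` replaces the free index `d` of `r` by `s` (whose free indices are shifted by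
`d`) and lowers the larger free indices by one. In particular `subst 0 r s` is `r[s/x]`, where
`x` is the variable bound by the abstraction of which `r` is the body. -/
def subst (d : ℕ) (r s : Tm) (p : Pos) : Option TmLabel :=
  match r [] with
  | some (.var i) =>
      if i = d then lift d s p
      else match p with
        | [] => some (.var (if i < d then i else i - 1))
        | _ :: _ => none
  | l =>
      match p with
      | [] => l
      | k :: p' => subst (if k = 0 then d + 1 else d) (sub r [k]) s p'

open Classical in
/-- `Step b t t'`: the subterm of `t` at `b` is a redex `(λx.r) s`, and `t'` is `t` with this
subterm replaced by `r[s/x]`. -/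
def Step (b : Pos) (t t' : Tm) : Prop :=
  t b = some .app ∧ t (b ++ [1]) = some .lam ∧
  ∀ p, t' p =
    if b <+: p then subst 0 (sub t (b ++ [1, 0])) (sub t (b ++ [2])) (p.drop b.length)
    else t p

/-- `t 0 → t 1 → …`, with the redex contracted by the step `n` at position `b n`, is a strongly
converging reduction sequence of `001`-terms of length `len ≤ ω` with limit `t'`. A finite
sequence is continued by its last term. -/
structure StronglyConverges (len : ℕ∞) (t : ℕ → Tm) (b : ℕ → Pos) (t' : Tm) : Prop where
  terms : ∀ n, IsTerm001 (t n)
  step : ∀ n : ℕ, (n : ℕ∞) < len → Step (b n) (t n) (t (n + 1))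
  stay : ∀ n : ℕ, len ≤ (n : ℕ∞) → t (n + 1) = t n
  depth : len = ⊤ → Filter.Tendsto (fun n => appDepth (b n)) Filter.atTop Filter.atTop
  limit : ∀ p, ∀ᶠ n in Filter.atTop, t n p = t' p

/-! ### Rigid types -/

/-- Labels of types: type variables and the arrow. -/
inductive TyLabel where
  | tvar (α : ℕ)
  | arr
  deriving DecidableEq

/-- Labelled trees for types and for sequence types. -/
abbrev TyTree := LTree TyLabel

/-- The rigid types (the set `Types`): a type variable is a leaf, an arrow has the child `1`
(its head) and arbitrary children on argument tracks (its tail), and no infinite branch ends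
by `1, 1, 1, …`. -/
def IsTy (T : TyTree) : Prop :=
  (T []).isSome ∧
  (∀ c k, (T (c ++ [k])).isSome → T c = some .arr ∧ k ≠ 0) ∧
  (∀ c, T c = some .arr → (T (c ++ [1])).isSome) ∧
  (∀ c, ∃ n : ℕ, T (c ++ List.replicate n 1) = none)

/-- The sequence types `(T_k)_{k ∈ K}` with `K ⊆ ℕ - {0, 1}`, where `T_k` is read at the
positions that begin with `k`. -/
def IsSeqTy (F : TyTree) : Prop :=
  F [] = none ∧ (∀ k c, k < 2 → F (k :: c) = none) ∧
  ∀ k, 2 ≤ k → (∀ c, F (k :: c) = none) ∨ IsTy (fun c => F (k :: c))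

/-- The roots of a sequence type. -/
def roots (F : TyTree) : Set ℕ := {k | (F [k]).isSome}

/-- The sequence type `k · T`. -/
def single (k : ℕ) (T : TyTree) : TyTree
  | [] => none
  | j :: c => if j = k then T c else none

/-- The type `F → T`. -/
def arrow (F T : TyTree) : TyTree
  | [] => some .arr
  | k :: c => if k = 1 then T c else F (k :: c)

/-- The sequence types of the family have pairwise disjoint sets of roots. -/
def DisjointFam {ι : Type} (G : ι → TyTree) : Prop :=
  ∀ i j, i ≠ j → Disjoint (roots (G i)) (roots (G j))

/-- The join of a (disjoint) family of sequence types. -/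
def join {ι : Type} (G : ι → TyTree) : TyTree := fun c => pick (fun v => ∃ i, G i c = some v)

/-! ### Rigid derivations -/

/-- A context gives a sequence type to each variable (de Bruijn index). -/
abbrev Ctx := ℕ → TyTree

/-- The judgment `ctx ⊢ term : ty`. -/
structure Judgment where
  ctx : Ctx
  term : Tm
  ty : TyTree

/-- The components of a judgment range over the right sets. -/
def Judgment.WF (J : Judgment) : Prop :=
  (∀ i, IsSeqTy (J.ctx i)) ∧ IsTerm001 J.term ∧ IsTy J.ty

/-- Trees labelled with judgments. -/
abbrev JTree := LTree Judgment

/-- The context of the judgment at position `a` (empty if there is none). -/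
def ctxAt (P : JTree) (a : Pos) : Ctx :=
  match P a with
  | some J => J.ctx
  | none => fun _ => emptyTree

/-- The sequence of the types of the premises of `a` on argument tracks. -/
def argTypes (P : JTree) (a : Pos) : TyTree
  | [] => none
  | k :: c => if 2 ≤ k then (P (a ++ [k])).bind (fun J => J.ty c) else none

/-- The node `a` of `P` is an axiom `x : k · T ⊢ x : T`. -/
def AxRule (P : JTree) (a : Pos) (J : Judgment) : Prop :=
  (∀ l, P (a ++ [l]) = none) ∧
  ∃ i k, J.term [] = some (.var i) ∧ 2 ≤ k ∧
    J.ctx = fun j => if j = i then single k J.ty else emptyTree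

/-- The node `a` of `P` is an abstraction rule: from `C ⊢ t : T` infer
`C - x ⊢ λx.t : C(x) → T`. -/
def AbsRule (P : JTree) (a : Pos) (J : Judgment) : Prop :=
  (∀ l, l ≠ 0 → P (a ++ [l]) = none) ∧
  J.term [] = some .lam ∧
  ∃ J₀, P (a ++ [0]) = some J₀ ∧ J₀.term = sub J.term [0] ∧
    J.ctx = (fun i => J₀.ctx (i + 1)) ∧ J.ty = arrow (J₀.ctx 0) J₀.ty

/-- The node `a` of `P` is an application rule: from `C ⊢ t : (S_k) → T` and a family of
premises `D_k ⊢ u : S_k` on argument tracks `k`, with pairwise disjoint contexts, infer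
`C ∪ ⋃ D_k ⊢ t u : T`. -/
def AppRule (P : JTree) (a : Pos) (J : Judgment) : Prop :=
  P (a ++ [0]) = none ∧
  J.term [] = some .app ∧
  (∃ J₁, P (a ++ [1]) = some J₁ ∧ J₁.term = sub J.term [1] ∧
    J₁.ty = arrow (argTypes P a) J.ty) ∧
  (∀ k J', 2 ≤ k → P (a ++ [k]) = some J' → J'.term = sub J.term [2]) ∧
  ∀ i, DisjointFam (fun l : ℕ => ctxAt P (a ++ [l]) i) ∧
    J.ctx i = join (fun l : ℕ => ctxAt P (a ++ [l]) i)

/-- Rigid derivations. Since the rules are read coinductively, a derivation is any labelled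
tree, possibly infinite, all of whose nodes are correct. -/
def IsDerivation (P : JTree) : Prop :=
  (P []).isSome ∧
  (∀ a k, (P (a ++ [k])).isSome → (P a).isSome) ∧
  ∀ a J, P a = some J → J.WF ∧ (AxRule P a J ∨ AbsRule P a J ∨ AppRule P a J)

/-- `P` is a derivation of `C ⊢ t : T`. -/
def Proves (P : JTree) (C : Ctx) (t : Tm) (T : TyTree) : Prop :=
  IsDerivation P ∧ P [] = some ⟨C, t, T⟩

/-- `a · q` is an axiom leaf of `P`, with axiom track `k`, for the variable that has index `i`
at position `a`. -/
def IsAxLeaf (P : JTree) (a : Pos) (i k : ℕ) (q : Pos) : Prop :=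
  ∃ J, P (a ++ q) = some J ∧ J.term [] = some (.var (i + binders q)) ∧
    k ∈ roots (J.ctx (i + binders q))

/-- Quantitative derivations: every context is the union of the `tr(a') · T(a')`, for `a'`
ranging over the axiom leaves above that type the variable. -/
def Quantitative (P : JTree) : Prop :=
  ∀ a J, P a = some J → ∀ i,
    ∀ c v, J.ctx i c = some v ↔
      ∃ q k J', IsAxLeaf P a i k q ∧ P (a ++ q) = some J' ∧ single k J'.ty c = some v

/-! ### Bipositions and approximability -/

/-- Right bipositions `(a, c)` and left bipositions `(a, x, c)`. -/
inductive BiPos where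
  | right (a c : Pos)
  | left (a : Pos) (i : ℕ) (c : Pos)

/-- The type symbol of `P` at a biposition. -/
def symbolAt (P : JTree) : BiPos → Option TyLabel
  | .right a c => (P a).bind (fun J => J.ty c)
  | .left a i c => (P a).bind (fun J => J.ctx i c)

def bisupp (P : JTree) : Set BiPos := {β | (symbolAt P β).isSome}

/-- `Q` is a finite approximation of `P`: a derivation typing the same term, with a finite
bisupport, and the restriction of `P` to this bisupport. -/
def IsFiniteApprox (Q P : JTree) : Prop :=
  IsDerivation Q ∧ (Q []).map Judgment.term = (P []).map Judgment.term ∧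
  (bisupp Q).Finite ∧ bisupp Q ⊆ bisupp P ∧ ∀ β ∈ bisupp Q, symbolAt Q β = symbolAt P β

def Approximable (P : JTree) : Prop :=
  ∀ B : Set BiPos, B.Finite → B ⊆ bisupp P → ∃ Q, IsFiniteApprox Q P ∧ B ⊆ bisupp Q

/-! ### Reduction of derivations -/

/-- The context of a term whose free indices are shifted by `d`, seen under `e` binders. -/
def liftCtx (d e : ℕ) (C : Ctx) : Ctx := fun i =>
  if i < e then C i else if i < e + d then emptyTree else C (i - d)

open Classical in
/-- The residual context inside the body of the redex at `a`, under `d` binders of that body,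
where the context was `C`: remove the variable `x` of the redex (index `d`), and add the
contexts of the argument derivations on the tracks `k` of `C(x)`. -/
def bodyCtx (P : JTree) (a : Pos) (d : ℕ) (C : Ctx) : Ctx := fun i =>
  if i < d then C i
  else join (fun l : Option ℕ => match l with
    | none => C (i + 1)
    | some k => if k ∈ roots (C d) then ctxAt P (a ++ [k]) (i - d) else emptyTree)

/-- `Residual P b α α' C'`: when the redex at `b` is fired, the position `α` of `P` has the
residual `α'`, and `C'` is the context to be put there. The argument derivation on track `k`
moves to the axiom leaf of `x` that has axiom track `k`; the nodes of the body of the redex,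
except the axiom leaves of `x`, move down by `1 · 0`; the nodes not above `b` stay in place. -/
inductive Residual (P : JTree) (b : Pos) : Pos → Pos → Ctx → Prop
  | arg (a q α : Pos) (k : ℕ) (J : Judgment) (ha : collapse a = b) (hk : 2 ≤ k)
      (hq : IsAxLeaf P (a ++ [1, 0]) 0 k q) (hJ : P (a ++ [k] ++ α) = some J) :
      Residual P b (a ++ [k] ++ α) (a ++ q ++ α) (liftCtx (binders q) (binders α) J.ctx)
  | body (a α : Pos) (J : Judgment) (ha : collapse a = b)
      (hJ : P (a ++ [1, 0] ++ α) = some J) (hx : J.term [] ≠ some (.var (binders α))) :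
      Residual P b (a ++ [1, 0] ++ α) (a ++ α) (bodyCtx P a (binders α) J.ctx)
  | out (α : Pos) (J : Judgment) (hb : ¬ b <+: collapse α) (hJ : P α = some J) :
      Residual P b α α J.ctx

/-- The labelled tree obtained from a derivation `P` typing `t` when `t` is reduced to `t'` at
position `b`: the residual `α'` of `α` is labelled with `C'(α') ⊢ t'|_{α'} : T(α)`. -/
def reduct (P : JTree) (b : Pos) (t' : Tm) : JTree := fun α' =>
  pick (fun J' => ∃ α C' J, Residual P b α α' C' ∧ P α = some J ∧
    J' = ⟨C', sub t' (collapse α'), J.ty⟩)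

open Classical in
/-- The successive reducts of `P` along a reduction sequence. -/
def reducts (len : ℕ∞) (t : ℕ → Tm) (b : ℕ → Pos) (P : JTree) : ℕ → JTree
  | 0 => P
  | n + 1 =>
      if (n : ℕ∞) < len then reduct (reducts len t b P n) (b n) (t (n + 1))
      else reducts len t b P n

/-- The context and the type at position `a`, if `a` is in the support. -/
def ctxTy (P : JTree) (a : Pos) : Option (Ctx × TyTree) := (P a).map (fun J => (J.ctx, J.ty))

/-- The limit of a sequence of labelled trees, as a labelled tree for `t'`: a position in the
support is labelled with the eventual context, the subterm of `t'`, and the eventual type. -/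
def limitTree (Q : ℕ → JTree) (t' : Tm) : JTree := fun a =>
  (pick (fun v => ∀ᶠ n in Filter.atTop, ctxTy (Q n) a = some v)).map
    (fun v => ⟨v.1, sub t' (collapse a), v.2⟩)

end RigidTyping

end

open RigidTyping

namespace RigidTyping

/-! ### Choice of a value -/

/-! In a quantitative derivation every context is read off from the axiom leaves above it, and two
leaves that type the same variable above a common node have different axiom tracks
(`Quantitative.leaf_unique`). At a redex `(λx.r) s`, syntactic equality of types makes the family of
types of the argument premises equal to the sequence type of `x` in the body. So argument
derivations and axiom leaves of `x` correspond one to one, track by track and with equal types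
(`arg_of_leaf`, `leaf_of_arg`). Reduction plugs each argument derivation into its leaf; nothing is
duplicated, and residuals are unique in both directions.

Subject reduction for one step does not check the contexts rule by rule. The leaves of the reduct
are matched with those of the original derivation, which shows that the reduct is quantitative and
that its leaves still have distinct tracks; types are carried along unchanged. By
`isDerivation_of_quantitative` this suffices: disjointness and unions of contexts follow from the
leaves.

For the limit, a step at `b` affects only positions whose collapse extends `b`, so a position
freezes once all later redexes are longer than it. Correctness of a node involves only the node and
its premises, hence the limit inherits it from a late reduct (`isDerivation_of_local`). The limit
term is a `001`-term because the applicative depth of the redexes tends to infinity.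

For approximability, a derivation of finite depth is automatically quantitative, so a finite
approximation can be reduced along the same sequence. Reduction is monotone (`approx_reduct`),
continuous (`exists_finite_bisupp`) and never increases the number of nodes (`ncard_supp_reduct`). A
finite part of the limit already lies in some late reduct, so it depends on a finite part of the
initial derivation, which some finite approximation contains. The limit of the reducts of this
approximation is the required one; it is finite because the number of nodes bounds the height of all
the reducts. -/

theorem pick_spec {L : Type} {p : L → Prop} {v : L} (h : pick p = some v) : p v := by
  unfold pick at h
  split_ifs at h with h'
  cases h
  exact h'.choose_spec

theorem pick_isSome {L : Type} {p : L → Prop} {v : L} (h : p v) : ∃ w, pick p = some w := by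
  unfold pick
  rw [dif_pos ⟨v, h⟩]
  exact ⟨_, rfl⟩

theorem pick_eq_some_iff {L : Type} {p : L → Prop} (hu : ∀ u w, p u → p w → u = w) {v : L} :
    pick p = some v ↔ p v := by
  refine ⟨pick_spec, fun h => ?_⟩
  obtain ⟨w, hw⟩ := pick_isSome h
  rw [hw, hu _ _ (pick_spec hw) h]

theorem pick_eq_none {L : Type} {p : L → Prop} (h : ∀ v, ¬ p v) : pick p = none := by
  unfold pick
  rw [dif_neg (by simpa using h)]

/-! ### Positions -/

@[simp] theorem collapse_nil : collapse [] = [] := rfl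

@[simp] theorem collapse_cons (k : ℕ) (a : Pos) : collapse (k :: a) = min k 2 :: collapse a := rfl

@[simp] theorem collapse_append (a c : Pos) : collapse (a ++ c) = collapse a ++ collapse c := by
  simp [collapse]

@[simp] theorem length_collapse (a : Pos) : (collapse a).length = a.length := by
  simp [collapse]

@[simp] theorem binders_nil : binders [] = 0 := rfl

@[simp] theorem binders_append (a c : Pos) : binders (a ++ c) = binders a + binders c := by
  simp [binders]

@[simp] theorem binders_zero_cons (a : Pos) : binders (0 :: a) = binders a + 1 := by
  simp [binders]

@[simp] theorem binders_succ_cons (k : ℕ) (a : Pos) : binders ((k + 1) :: a) = binders a := by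
  simp [binders]

@[simp] theorem binders_one_cons (a : Pos) : binders (1 :: a) = binders a := by
  simp [binders]

theorem binders_cons_of_ne {k : ℕ} (h : k ≠ 0) (a : Pos) : binders (k :: a) = binders a := by
  simp [binders, h]

@[simp] theorem binders_collapse (a : Pos) : binders (collapse a) = binders a := by
  induction a with
  | nil => rfl
  | cons k a ih =>
    rcases k with _ | k
    · simp [ih]
    · have : min (k + 1) 2 ≠ 0 := by omega
      rw [collapse_cons, binders_cons_of_ne this, ih, binders_succ_cons]

theorem prefix_collapse_iff {b α : Pos} :
    b <+: collapse α ↔ ∃ a γ, α = a ++ γ ∧ collapse a = b := by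
  constructor
  · rintro ⟨c, hc⟩
    unfold collapse at hc
    obtain ⟨a, γ, h1, h2, -⟩ := List.map_eq_append_iff.1 hc.symm
    exact ⟨a, γ, h1, h2⟩
  · rintro ⟨a, γ, rfl, rfl⟩
    simp

/-- Collapsing preserves lengths. Hence the positions that collapse to one redex `b` are pairwise
incomparable, and a position lies above at most one of them. -/
theorem append_inj_of_collapse {a a' γ γ' b : Pos} (h : a ++ γ = a' ++ γ') (ha : collapse a = b)
    (ha' : collapse a' = b) : a = a' ∧ γ = γ' :=
  List.append_inj h (by rw [← length_collapse a, ← length_collapse a', ha, ha'])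

/-! ### Substitution -/

/-- Labels of a substituted body: the index `d` is removed. -/
def lowerLabel (d : ℕ) : TmLabel → TmLabel
  | .var i => .var (if i < d then i else i - 1)
  | l => l

/-- No position of the support lies strictly above a variable. -/
def VarLeaves (r : Tm) : Prop :=
  ∀ p i x, r p = some (.var i) → x ≠ [] → r (p ++ x) = none

theorem VarLeaves.sub {r : Tm} (h : VarLeaves r) (a : Pos) : VarLeaves (sub r a) := by
  intro p i x hp hx
  simpa [RigidTyping.sub] using h (a ++ p) i x hp hx

theorem IsTerm.varLeaves {t : Tm} (h : IsTerm t) : VarLeaves t := by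
  intro p i x hp hx
  induction x using List.reverseRecOn with
  | nil => exact absurd rfl hx
  | append_singleton x k ih =>
    rw [← List.append_assoc]
    by_contra hc
    have := (h.2 (p ++ x) k).1 (Option.isSome_iff_ne_none.2 hc)
    rcases eq_or_ne x [] with rfl | hx'
    · simp [hp] at this
    · simp [ih hx'] at this

theorem IsTerm.sub {t : Tm} (h : IsTerm t) {a : Pos} (ha : (t a).isSome) : IsTerm (sub t a) :=
  ⟨by simpa [RigidTyping.sub] using ha, fun p k => by
    simpa [RigidTyping.sub] using h.2 (a ++ p) k⟩

theorem IsTerm.isSome_of_append {t : Tm} (h : IsTerm t) {p : Pos} (x : Pos)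
    (hx : (t (p ++ x)).isSome) : (t p).isSome := by
  induction x using List.reverseRecOn with
  | nil => simpa using hx
  | append_singleton x k ih =>
    apply ih
    rw [← List.append_assoc] at hx
    rcases (h.2 (p ++ x) k).1 hx with ⟨-, h'⟩ | ⟨-, h'⟩ <;> simp [h']

/-- The recursion of `subst` follows `q` and raises `d` at each track `0`, so the same number `d +
binders q` names the substituted variable and lifts the argument. `VarLeaves` prevents the recursion
from stopping at a variable before the end of `q`. -/
theorem subst_var (s : Tm) : ∀ (q : Pos) (d : ℕ) (r : Tm) (p : Pos), VarLeaves r →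
    r q = some (.var (d + binders q)) → subst d r s (q ++ p) = lift (d + binders q) s p
  | [], d, r, p, _, h => by
    unfold subst
    simp only [binders_nil, Nat.add_zero] at h
    simp [h]
  | k :: q, d, r, p, hr, h => by
    have h0 : ∀ i, r [] ≠ some (.var i) := fun i hi => by
      have := hr [] i (k :: q) hi (by simp)
      simp_all
    have key := subst_var s q (if k = 0 then d + 1 else d) (sub r [k]) p (hr.sub _) (by
      simp only [sub, List.cons_append, List.nil_append, h]
      rcases k with _ | k <;> simp; omega)
    rw [List.cons_append]
    unfold subst
    split
    · rename_i i hi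
      exact absurd hi (h0 i)
    · simp only
      rw [key]
      congr 1
      rcases k with _ | k <;> simp; omega

theorem subst_of_ne (s : Tm) : ∀ (p : Pos) (d : ℕ) (r : Tm) (l : TmLabel), VarLeaves r →
    r p = some l → l ≠ .var (d + binders p) →
      subst d r s p = some (lowerLabel (d + binders p) l)
  | [], d, r, l, _, h, hl => by
    unfold subst
    rcases l with i | _ | _
    · have : i ≠ d := by simpa using hl
      simp [h, this, lowerLabel]
    · simp [h, lowerLabel]
    · simp [h, lowerLabel]
  | k :: p, d, r, l, hr, h, hl => by
    have h0 : ∀ i, r [] ≠ some (.var i) := fun i hi => by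
      have := hr [] i (k :: p) hi (by simp)
      simp_all
    have e : (if k = 0 then d + 1 else d) + binders p = d + binders (k :: p) := by
      rcases k with _ | k <;> simp; omega
    have key := subst_of_ne s p (if k = 0 then d + 1 else d) (sub r [k]) l (hr.sub _) h
      (by rwa [e])
    unfold subst
    split
    · rename_i i hi
      exact absurd hi (h0 i)
    · simp only
      rw [key, e]

theorem Step.eq_of_not_prefix {b : Pos} {t t' : Tm} (h : Step b t t') {p : Pos}
    (hp : ¬ b <+: p) : t' p = t p := by
  rw [h.2.2 p, if_neg hp]

theorem Step.eq_subst {b : Pos} {t t' : Tm} (h : Step b t t') (p : Pos) :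
    t' (b ++ p) = subst 0 (sub t (b ++ [1, 0])) (sub t (b ++ [2])) p := by
  rw [h.2.2 (b ++ p), if_pos (List.prefix_append _ _), List.drop_left]

/-! ### Sequence types and contexts -/

theorem single_cons {k j : ℕ} {T : TyTree} {c : Pos} :
    single k T (j :: c) = if j = k then T c else none := rfl

theorem single_eq_some {k : ℕ} {T : TyTree} {c : Pos} {v : TyLabel} :
    single k T c = some v ↔ ∃ c', c = k :: c' ∧ T c' = some v := by
  rcases c with _ | ⟨j, c⟩
  · simp [single]
  · rw [single_cons]
    split_ifs with h
    · simp [h]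
    · simp [h]

theorem single_self {k : ℕ} {T : TyTree} {c : Pos} : single k T (k :: c) = T c := by
  simp [single_cons]

theorem roots_single {k : ℕ} {T : TyTree} (hT : (T []).isSome) : roots (single k T) = {k} := by
  ext j
  simp only [roots, Set.mem_ofPred_eq, single_cons, Set.mem_singleton_iff]
  split_ifs with h <;> simp [h, hT]

@[simp] theorem roots_emptyTree : roots (emptyTree) = ∅ := by
  ext j
  simp [roots, emptyTree]

theorem ltree_ext {L : Type} {S T : LTree L} (h : ∀ c v, S c = some v ↔ T c = some v) : S = T :=
  funext fun c => Option.ext fun v => h c v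

/-- An arrow does not record the values of its tail at the root and above track `1`, hence the two
extra hypotheses. -/
theorem arrow_inj {F F' T T' : TyTree} (h : arrow F T = arrow F' T') (h0 : F [] = F' [])
    (h1 : ∀ c, F (1 :: c) = F' (1 :: c)) : F = F' ∧ T = T' := by
  constructor
  · funext c
    rcases c with _ | ⟨k, c⟩
    · exact h0
    · by_cases hk : k = 1
      · rw [hk, h1]
      · simpa [arrow, hk] using congrFun h (k :: c)
  · funext c
    simpa [arrow] using congrFun h (1 :: c)

/-- The context of an axiom. -/
def axCtx (i k : ℕ) (T : TyTree) : Ctx := fun j => if j = i then single k T else emptyTree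

@[simp] theorem axCtx_self (i k : ℕ) (T : TyTree) : axCtx i k T i = single k T := by
  simp [axCtx]

theorem axCtx_of_ne {i j k : ℕ} (h : j ≠ i) (T : TyTree) : axCtx i k T j = emptyTree := by
  simp [axCtx, h]

/-- The node `α` is an axiom leaf with index `j`, axiom track `k` and type `T`. -/
def Entry (P : JTree) (α : Pos) (j k : ℕ) (T : TyTree) : Prop :=
  ∃ s, P α = some ⟨axCtx j k T, s, T⟩ ∧ s [] = some (.var j)

/-- The nodes that are labelled with a variable have the context of an axiom. -/
def AxForm (P : JTree) : Prop :=
  ∀ a J i, P a = some J → J.term [] = some (.var i) →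
    ∃ k, 2 ≤ k ∧ J.ctx = axCtx i k J.ty ∧ (J.ty []).isSome

theorem AxForm.entry {P : JTree} (h : AxForm P) {a : Pos} {J : Judgment} {i : ℕ}
    (ha : P a = some J) (hi : J.term [] = some (.var i)) : ∃ k, 2 ≤ k ∧ Entry P a i k J.ty := by
  obtain ⟨k, hk, hc, -⟩ := h a J i ha hi
  refine ⟨k, hk, J.term, ?_, hi⟩
  rw [ha, ← hc]

theorem Entry.node {P : JTree} {α : Pos} {j k : ℕ} {S : TyTree} (h : Entry P α j k S) :
    (P α).isSome := by
  obtain ⟨s, hs, -⟩ := h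
  rw [hs]
  rfl

theorem Entry.isSome {P : JTree} (h : AxForm P) {α : Pos} {j k : ℕ} {T : TyTree}
    (he : Entry P α j k T) : (T []).isSome := by
  obtain ⟨s, hs, hj⟩ := he
  obtain ⟨_, _, _, h'⟩ := h _ _ _ hs hj
  exact h'

/-- The track can be recovered from the context because a type has a root symbol, so that the roots
of `single k T` are exactly `k`. -/
theorem Entry.unique {P : JTree} (h : AxForm P) {α : Pos} {j k j' k' : ℕ} {T T' : TyTree}
    (he : Entry P α j k T) (he' : Entry P α j' k' T') : j = j' ∧ k = k' ∧ T = T' := by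
  have hT := he.isSome h
  obtain ⟨s, hs, hj⟩ := he
  obtain ⟨s', hs', hj'⟩ := he'
  rw [hs, Option.some_inj, Judgment.mk.injEq] at hs'
  obtain ⟨hc, rfl, rfl⟩ := hs'
  rw [hj, Option.some_inj, TmLabel.var.injEq] at hj'
  subst hj'
  refine ⟨rfl, ?_, rfl⟩
  have := congrFun hc j
  rw [axCtx_self, axCtx_self] at this
  have h2 := roots_single (k := k) hT
  rw [this, roots_single hT] at h2
  simpa using h2.symm

theorem Entry.two_le {P : JTree} (h : AxForm P) {α : Pos} {j k : ℕ} {T : TyTree}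
    (he : Entry P α j k T) : 2 ≤ k := by
  obtain ⟨s, hs, hj⟩ := id he
  obtain ⟨k', hk', he'⟩ := h.entry hs hj
  rwa [(he.unique h he').2.1]

theorem isAxLeaf_iff {P : JTree} (h : AxForm P) {a q : Pos} {i k : ℕ} :
    IsAxLeaf P a i k q ↔ ∃ T, Entry P (a ++ q) (i + binders q) k T := by
  constructor
  · rintro ⟨J, hJ, hi, hk⟩
    obtain ⟨k', hk', hc, hT⟩ := h _ _ _ hJ hi
    rw [hc, axCtx_self, roots_single hT, Set.mem_singleton_iff] at hk
    subst hk
    exact ⟨J.ty, J.term, by rw [hJ, ← hc], hi⟩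
  · rintro ⟨T, he⟩
    have hT := he.isSome h
    obtain ⟨s, hs, hi⟩ := he
    exact ⟨_, hs, hi, by simp [roots_single hT]⟩

/-- Only `AxForm` is assumed, because this form of quantitativity is needed for the reduct before
the reduct is known to be a derivation. -/
theorem quantitative_iff {P : JTree} (h : AxForm P) : Quantitative P ↔
    ∀ a J, P a = some J → ∀ i c v, J.ctx i c = some v ↔
      ∃ q k T, Entry P (a ++ q) (i + binders q) k T ∧ single k T c = some v := by
  unfold Quantitative
  have key : ∀ a i c v, (∃ q k J', IsAxLeaf P a i k q ∧ P (a ++ q) = some J' ∧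
      single k J'.ty c = some v) ↔
      ∃ q k T, Entry P (a ++ q) (i + binders q) k T ∧ single k T c = some v := by
    intro a i c v
    constructor
    · rintro ⟨q, k, J', hl, hJ', hc⟩
      obtain ⟨T, he⟩ := (isAxLeaf_iff h).1 hl
      refine ⟨q, k, T, he, ?_⟩
      obtain ⟨s, hs, -⟩ := he
      rw [hJ', Option.some_inj] at hs
      rwa [hs] at hc
    · rintro ⟨q, k, T, he, hc⟩
      obtain ⟨s, hs, hi⟩ := id he
      exact ⟨q, k, _, (isAxLeaf_iff h).2 ⟨T, he⟩, hs, hc⟩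
  simp only [key]

/-! ### Structure of derivations -/

theorem ctxAt_of_eq {P : JTree} {a : Pos} {J : Judgment} (h : P a = some J) :
    ctxAt P a = J.ctx := by
  simp [ctxAt, h]

theorem ctxAt_of_none {P : JTree} {a : Pos} (h : P a = none) :
    ctxAt P a = fun _ => emptyTree := by
  simp [ctxAt, h]

theorem ctxAt_eq_some {P : JTree} {a : Pos} {i : ℕ} {c : Pos} {v : TyLabel} :
    ctxAt P a i c = some v ↔ ∃ J, P a = some J ∧ J.ctx i c = some v := by
  rcases h : P a with _ | J
  · simp [ctxAt_of_none h, emptyTree]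
  · simp [ctxAt_of_eq h]

theorem IsDerivation.isSome_of_append {P : JTree} (h : IsDerivation P) {a : Pos} (q : Pos)
    (hq : (P (a ++ q)).isSome) : (P a).isSome := by
  induction q using List.reverseRecOn with
  | nil => simpa using hq
  | append_singleton q k ih =>
    rw [← List.append_assoc] at hq
    exact ih (h.2.1 _ _ hq)

theorem IsDerivation.axForm {P : JTree} (h : IsDerivation P) : AxForm P := by
  intro a J i ha hi
  obtain ⟨hw, hr⟩ := h.2.2 a J ha
  rcases hr with ⟨-, i', k, h1, h2, h3⟩ | ⟨-, h1, -⟩ | ⟨-, h1, -⟩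
  · rw [hi, Option.some_inj, TmLabel.var.injEq] at h1
    subst h1
    exact ⟨k, h2, h3, hw.2.2.1⟩
  · simp [hi] at h1
  · simp [hi] at h1

theorem IsDerivation.no_child_of_var {P : JTree} (h : IsDerivation P) {a : Pos} {J : Judgment}
    {i : ℕ} (ha : P a = some J) (hi : J.term [] = some (.var i)) (l : ℕ) :
    P (a ++ [l]) = none := by
  obtain ⟨hw, hr⟩ := h.2.2 a J ha
  rcases hr with ⟨h0, -⟩ | ⟨-, h1, -⟩ | ⟨-, h1, -⟩
  · exact h0 l
  · simp [hi] at h1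
  · simp [hi] at h1

theorem IsDerivation.eq_nil_of_var {P : JTree} (h : IsDerivation P) {a q : Pos} {J : Judgment}
    {i : ℕ} (ha : P a = some J) (hi : J.term [] = some (.var i)) (hq : (P (a ++ q)).isSome) :
    q = [] := by
  rcases q with _ | ⟨l, q⟩
  · rfl
  · have := h.isSome_of_append (a := a ++ [l]) q (by simpa using hq)
    simp [h.no_child_of_var ha hi l] at this

theorem IsDerivation.absRule {P : JTree} (h : IsDerivation P) {a : Pos} {J : Judgment}
    (ha : P a = some J) (hi : J.term [] = some .lam) : AbsRule P a J := by
  obtain ⟨hw, hr⟩ := h.2.2 a J ha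
  rcases hr with ⟨-, i', k, h1, -⟩ | h' | ⟨-, h1, -⟩
  · simp [hi] at h1
  · exact h'
  · simp [hi] at h1

theorem IsDerivation.appRule {P : JTree} (h : IsDerivation P) {a : Pos} {J : Judgment}
    (ha : P a = some J) (hi : J.term [] = some .app) : AppRule P a J := by
  obtain ⟨hw, hr⟩ := h.2.2 a J ha
  rcases hr with ⟨-, i', k, h1, -⟩ | ⟨-, h1, -⟩ | h'
  · simp [hi] at h1
  · simp [hi] at h1
  · exact h'

theorem Proves.term_eq {P : JTree} {C : Ctx} {t : Tm} {T : TyTree} (h : Proves P C t T)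
    (a : Pos) : ∀ J, P a = some J → J.term = sub t (collapse a) := by
  induction a using List.reverseRecOn with
  | nil =>
    intro J hJ
    rw [h.2, Option.some_inj] at hJ
    rw [← hJ]
    rfl
  | append_singleton a k ih =>
    intro J hJ
    obtain ⟨J₀, hJ₀⟩ := Option.isSome_iff_exists.1 (h.1.2.1 a k (by simp [hJ]))
    have e := ih J₀ hJ₀
    have e' : ∀ l, sub J₀.term l = sub t (collapse a ++ l) := fun l => by
      rw [e]
      funext p
      simp [sub]
    rcases (h.1.2.2 a J₀ hJ₀).2 with ⟨h0, -⟩ | ⟨h0, -, J₁, h1, h2, -⟩ | ⟨h0, -, ⟨J₁, h1, h2, -⟩, h3, -⟩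
    · simp [h0] at hJ
    · by_cases hk : k = 0
      · subst hk
        rw [h1, Option.some_inj] at hJ
        rw [← hJ, h2, e']
        simp
      · simp [h0 k hk] at hJ
    · rcases Nat.lt_or_ge k 2 with hk | hk
      · interval_cases k
        · simp [h0] at hJ
        · rw [h1, Option.some_inj] at hJ
          rw [← hJ, h2, e']
          simp
      · rw [h3 k J hk hJ, e']
        simp [hk]

theorem Proves.label_eq {P : JTree} {C : Ctx} {t : Tm} {T : TyTree} (h : Proves P C t T)
    {a : Pos} {J : Judgment} (hJ : P a = some J) : J.term [] = t (collapse a) := by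
  rw [h.term_eq a J hJ]
  simp [sub]

theorem Entry.label_eq {P : JTree} {C : Ctx} {t : Tm} {T : TyTree} (h : Proves P C t T)
    {a : Pos} {j k : ℕ} {S : TyTree} (he : Entry P a j k S) :
    t (collapse a) = some (.var j) := by
  obtain ⟨s, hs, hj⟩ := he
  rw [← h.label_eq hs]
  exact hj

/-- In a quantitative derivation, the axiom leaves above a position that type the same
variable have different axiom tracks. -/
theorem Quantitative.leaf_unique {P : JTree} (hP : IsDerivation P) (hq : Quantitative P) :
    ∀ (q q' a : Pos) (i k : ℕ) (T T' : TyTree), Entry P (a ++ q) (i + binders q) k T →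
      Entry P (a ++ q') (i + binders q') k T' → q = q' := by
  have hQ := (quantitative_iff hP.axForm).1 hq
  intro q
  induction q with
  | nil =>
    intro q' a i k T T' he he'
    obtain ⟨s, hs, hj⟩ := he
    obtain ⟨s', hs', hj'⟩ := he'
    exact (hP.eq_nil_of_var (by simpa using hs) hj (by simp [hs'])).symm
  | cons l q ih =>
    intro q' a i k T T' he he'
    rcases q' with _ | ⟨l', q'⟩
    · obtain ⟨s, hs, hj⟩ := he
      obtain ⟨s', hs', hj'⟩ := he'
      exact hP.eq_nil_of_var (by simpa using hs') hj' (by rw [hs]; rfl)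
    have e : ∀ (l : ℕ) (q : Pos) (T : TyTree), Entry P (a ++ l :: q) (i + binders (l :: q)) k T →
        Entry P (a ++ [l] ++ q) ((i + binders [l]) + binders q) k T := fun l q T h => by
      have e1 : binders (l :: q) = binders [l] + binders q := by
        rw [← binders_append]
        rfl
      simpa [e1, Nat.add_assoc] using h
    replace he := e _ _ _ he
    replace he' := e _ _ _ he'
    have hs : ∃ J, P (a ++ [l]) = some J := by
      obtain ⟨s, hs, -⟩ := he
      exact Option.isSome_iff_exists.1 (hP.isSome_of_append q (by rw [hs]; rfl))
    have hs' : ∃ J, P (a ++ [l']) = some J := by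
      obtain ⟨s, hs, -⟩ := he'
      exact Option.isSome_iff_exists.1 (hP.isSome_of_append q' (by rw [hs]; rfl))
    by_cases hl : l = l'
    · subst hl
      rw [ih q' (a ++ [l]) _ k T T' he he']
    -- If the two paths separate at `a`, the track `k` is a root of the contexts of two premises of
    -- the same application, which are disjoint.
    · exfalso
      obtain ⟨J, hJ⟩ := hs
      obtain ⟨J', hJ'⟩ := hs'
      obtain ⟨J₀, hJ₀⟩ := Option.isSome_iff_exists.1 (hP.2.1 a l (by simp [hJ]))
      rcases (hP.2.2 a J₀ hJ₀).2 with ⟨h0, -⟩ | ⟨h0, -⟩ | ⟨h0, -, -, -, hd⟩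
      · simp [h0] at hJ
      · by_cases h : l = 0
        · rw [h0 l' (by omega)] at hJ'
          cases hJ'
        · rw [h0 l h] at hJ
          cases hJ
      · have hl0 : l ≠ 0 := by
          rintro rfl
          simp [h0] at hJ
        have hl0' : l' ≠ 0 := by
          rintro rfl
          simp [h0] at hJ'
        rw [binders_cons_of_ne hl0] at he
        rw [binders_cons_of_ne hl0'] at he'
        have hr : ∀ (l : ℕ) (J : Judgment) (q : Pos) (T : TyTree), P (a ++ [l]) = some J →
            Entry P (a ++ [l] ++ q) (i + binders [] + binders q) k T →
            k ∈ roots (ctxAt P (a ++ [l]) i) := fun l J q T hJ he => by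
          obtain ⟨v, hv⟩ := Option.isSome_iff_exists.1 (he.isSome hP.axForm)
          rw [ctxAt_of_eq hJ]
          exact Option.isSome_iff_exists.2 ⟨v, (hQ _ J hJ i [k] v).2
            ⟨q, k, T, by simpa using he, by rw [single_self]; exact hv⟩⟩
        exact Set.disjoint_left.1 ((hd i).1 l l' hl) (hr _ _ _ _ hJ he) (hr _ _ _ _ hJ' he')

/-! ### Joins, and residual contexts of axioms -/

theorem join_eq_some {ι : Type} {G : ι → TyTree} {c : Pos} {v : TyLabel}
    (hu : ∀ i j u w, G i c = some u → G j c = some w → u = w) :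
    join G c = some v ↔ ∃ i, G i c = some v :=
  pick_eq_some_iff fun u w ⟨i, hi⟩ ⟨j, hj⟩ => hu i j u w hi hj

theorem join_eq_of_unique {ι : Type} {G : ι → TyTree} (i : ι)
    (h : ∀ j, j ≠ i → G j = emptyTree) : join G = G i := by
  have h' : ∀ j c v, G j c = some v → j = i := fun j c v hj => by
    by_contra hc
    simp [h j hc, emptyTree] at hj
  refine ltree_ext fun c v => ?_
  rw [join_eq_some]
  · constructor
    · rintro ⟨j, hj⟩
      rwa [h' j c v hj] at hj
    · exact fun h => ⟨i, h⟩
  · intro j k u w hj hk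
    rw [h' j c u hj] at hj
    rw [h' k c w hk, hj] at hk
    simpa using hk

theorem liftCtx_axCtx (d e j k : ℕ) (T : TyTree) :
    liftCtx d e (axCtx j k T) = axCtx (if j < e then j else j + d) k T := by
  funext i
  unfold liftCtx axCtx
  split_ifs <;> first | rfl | omega

/-- A leaf of another variable gives no root to the index `d`, so no argument context is added and
the context remains that of an axiom. -/
theorem bodyCtx_axCtx (P : JTree) (a : Pos) {d j : ℕ} (h : j ≠ d) (k : ℕ) (T : TyTree) :
    bodyCtx P a d (axCtx j k T) = axCtx (if j < d then j else j - 1) k T := by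
  funext i
  unfold bodyCtx
  split_ifs with h1 h2 h2
  · rfl
  · rw [axCtx_of_ne (by omega), axCtx_of_ne (by omega)]
  · rw [join_eq_of_unique none]
    · simp only
      rw [axCtx_of_ne (by omega), axCtx_of_ne (by omega)]
    · rintro (_ | l) hl
      · exact absurd rfl hl
      · simp [axCtx_of_ne h.symm]
  · rw [join_eq_of_unique none]
    · simp only [axCtx]
      congr 1
      simp only [eq_iff_iff]
      omega
    · rintro (_ | l) hl
      · exact absurd rfl hl
      · simp [axCtx_of_ne h.symm]

/-- A quantitative derivation of `C ⊢ t : T`, and a reduction step `t → t'` at position `b`. -/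
structure Contraction (P : JTree) (C : Ctx) (T : TyTree) (b : Pos) (t t' : Tm) : Prop where
  proves : Proves P C t T
  quant : Quantitative P
  step : Step b t t'
  term : IsTerm t

namespace Contraction

variable {P : JTree} {C : Ctx} {T : TyTree} {b : Pos} {t t' : Tm}

theorem deriv (H : Contraction P C T b t t') : IsDerivation P := H.proves.1

theorem ctx_iff (H : Contraction P C T b t t') {a : Pos} {J : Judgment} (ha : P a = some J)
    (i : ℕ) (c : Pos) (v : TyLabel) : J.ctx i c = some v ↔
      ∃ q k S, Entry P (a ++ q) (i + binders q) k S ∧ single k S c = some v :=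
  (quantitative_iff H.deriv.axForm).1 H.quant a J ha i c v

theorem mem_roots (H : Contraction P C T b t t') {a : Pos} {J : Judgment} (ha : P a = some J)
    (i k : ℕ) : k ∈ roots (J.ctx i) ↔
      ∃ q S, Entry P (a ++ q) (i + binders q) k S := by
  constructor
  · intro h
    obtain ⟨v, hv⟩ := Option.isSome_iff_exists.1 h
    obtain ⟨q, k', S, he, hs⟩ := (H.ctx_iff ha i [k] v).1 hv
    obtain ⟨c', hc', -⟩ := single_eq_some.1 hs
    simp only [List.cons.injEq] at hc'
    exact ⟨q, S, hc'.1 ▸ he⟩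
  · rintro ⟨q, S, he⟩
    obtain ⟨v, hv⟩ := Option.isSome_iff_exists.1 (he.isSome H.deriv.axForm)
    exact Option.isSome_iff_exists.2 ⟨v, (H.ctx_iff ha i [k] v).2
      ⟨q, k, S, he, by rw [single_self]; exact hv⟩⟩

theorem leaf_unique (H : Contraction P C T b t t') {q q' a : Pos} {i k : ℕ} {S S' : TyTree}
    (h : Entry P (a ++ q) (i + binders q) k S) (h' : Entry P (a ++ q') (i + binders q') k S') :
    q = q' :=
  H.quant.leaf_unique H.deriv q q' a i k S S' h h'

theorem bound_leaf_unique (H : Contraction P C T b t t') {q q' a : Pos} {k : ℕ} {S S' : TyTree}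
    (h : Entry P (a ++ q) (binders q) k S) (h' : Entry P (a ++ q') (binders q') k S') :
    q = q' :=
  H.leaf_unique (i := 0) (by simpa using h) (by simpa using h')

theorem entry_unique (H : Contraction P C T b t t') {α : Pos} {j k j' k' : ℕ} {S S' : TyTree}
    (he : Entry P α j k S) (he' : Entry P α j' k' S') : j = j' ∧ k = k' ∧ S = S' :=
  he.unique H.deriv.axForm he'

/-- A leaf that lies below another one is equal to it. -/
theorem leaf_eq_of_append (H : Contraction P C T b t t') {α q : Pos} {j k : ℕ} {S : TyTree}
    (he : Entry P α j k S) (hq : (P (α ++ q)).isSome) : q = [] := by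
  obtain ⟨s, hs, hj⟩ := he
  exact H.deriv.eq_nil_of_var hs hj hq

/-- Two prefixes of one position are comparable, whereas nothing lies strictly above an axiom leaf.
A position inside a plugged argument thus determines the leaf that the argument replaced. -/
theorem leaf_prefix_unique (H : Contraction P C T b t t') {a q q' α α' : Pos} {j k j' k' : ℕ}
    {S S' : TyTree} (he : Entry P (a ++ q) j k S) (he' : Entry P (a ++ q') j' k' S')
    (h : q ++ α = q' ++ α') : q = q' ∧ α = α' := by
  have key : ∀ {q q' : Pos} {j k j' k' : ℕ} {S S' : TyTree}, Entry P (a ++ q) j k S →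
      Entry P (a ++ q') j' k' S' → q <+: q' → q = q' := by
    rintro q q' j k j' k' S S' he he' ⟨x, rfl⟩
    obtain ⟨s, hs, -⟩ := he'
    rw [H.leaf_eq_of_append he (q := x) (by rw [List.append_assoc, hs]; rfl), List.append_nil]
  have h1 : q' <+: q ++ α := h ▸ List.prefix_append q' α'
  rcases List.prefix_or_prefix_of_prefix (List.prefix_append q α) h1 with h' | h'
  · have := key he he' h'
    subst this
    exact ⟨rfl, by simpa using h⟩
  · have := key he' he h'
    subst this
    exact ⟨rfl, by simpa using h⟩

theorem label_eq (H : Contraction P C T b t t') {a : Pos} {J : Judgment} (hJ : P a = some J) :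
    J.term [] = t (collapse a) := H.proves.label_eq hJ

/-! ### The nodes of a redex -/

theorem redex_app (H : Contraction P C T b t t') {a : Pos} {J : Judgment} (ha : collapse a = b)
    (hJ : P a = some J) : AppRule P a J :=
  H.deriv.appRule hJ (by rw [H.label_eq hJ, ha, H.step.1])

theorem redex_abs (H : Contraction P C T b t t') {a : Pos} {J : Judgment} (ha : collapse a = b)
    (hJ : P (a ++ [1]) = some J) : AbsRule P (a ++ [1]) J :=
  H.deriv.absRule hJ (by rw [H.label_eq hJ, collapse_append, ha]; exact H.step.2.1)

theorem argTypes_cons {P : JTree} {a : Pos} {k : ℕ} {J : Judgment} (hk : 2 ≤ k)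
    (hJ : P (a ++ [k]) = some J) (c : Pos) : argTypes P a (k :: c) = J.ty c := by
  simp [argTypes, hk, hJ]

theorem argTypes_eq_some {P : JTree} {a c : Pos} {v : TyLabel} : argTypes P a c = some v ↔
    ∃ k c' J, c = k :: c' ∧ 2 ≤ k ∧ P (a ++ [k]) = some J ∧ J.ty c' = some v := by
  rcases c with _ | ⟨k, c⟩
  · simp [argTypes]
  · simp only [argTypes]
    split_ifs with h
    · simp [Option.bind_eq_some_iff, h]
    · simp only [List.cons.injEq, false_iff]
      rintro ⟨k, c', J, ⟨rfl, -⟩, h', -⟩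
      exact h h'

/-- The type of the abstraction is described twice: by the application below it, with the types of
the arguments as tail, and by the abstraction rule, with the sequence type of `x` as tail. Equality
of types being syntactic, the two tails agree track by track. -/
theorem redex_body (H : Contraction P C T b t t') {a : Pos} {J : Judgment} (ha : collapse a = b)
    (hJ : P a = some J) : ∃ J₁ J₂, P (a ++ [1]) = some J₁ ∧ P (a ++ [1, 0]) = some J₂ ∧
      J₂.ty = J.ty ∧ J₂.ctx 0 = argTypes P a ∧ J₁.ctx = fun i => J₂.ctx (i + 1) := by
  obtain ⟨-, -, ⟨J₁, h1, -, h2⟩, -⟩ := H.redex_app ha hJ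
  obtain ⟨-, -, J₂, h3, -, h4, h5⟩ := H.redex_abs ha h1
  rw [List.append_assoc] at h3
  refine ⟨J₁, J₂, h1, h3, ?_⟩
  have hw := (H.deriv.2.2 _ J₂ h3).1.1 0
  rw [h2] at h5
  obtain ⟨h6, h7⟩ := arrow_inj h5 (by rw [hw.1]; rfl) (fun c => by
    rw [hw.2.1 1 c (by omega)]
    simp [argTypes])
  exact ⟨h7.symm, h6.symm, h4⟩

/-- The argument derivation that corresponds to an axiom leaf of the variable of the redex. -/
theorem arg_of_leaf (H : Contraction P C T b t t') {a q : Pos} {k : ℕ} {S : TyTree}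
    (ha : collapse a = b) (he : Entry P (a ++ [1, 0] ++ q) (binders q) k S) :
    ∃ J, P (a ++ [k]) = some J ∧ J.ty = S := by
  have hs := he
  obtain ⟨s, hs, -⟩ := hs
  obtain ⟨J, hJ⟩ := Option.isSome_iff_exists.1 (H.deriv.isSome_of_append (a := a)
    ([1, 0] ++ q) (by rw [← List.append_assoc, hs]; rfl))
  obtain ⟨J₁, J₂, h1, h2, h3, h4, -⟩ := H.redex_body ha hJ
  obtain ⟨v, hv⟩ := Option.isSome_iff_exists.1 (he.isSome H.deriv.axForm)
  -- The component on track `k` of the sequence type of `x` is exactly `S`, since the given leaf is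
  -- the only one with this track.
  have key : ∀ c v, S c = some v ↔ J₂.ctx 0 (k :: c) = some v := by
    intro c v
    rw [H.ctx_iff h2]
    constructor
    · intro h
      exact ⟨q, k, S, by simpa using he, by rwa [single_self]⟩
    · rintro ⟨q', k', S', he', hc⟩
      obtain ⟨c', hc', hS⟩ := single_eq_some.1 hc
      simp only [List.cons.injEq] at hc'
      obtain ⟨rfl, rfl⟩ := hc'
      rw [Nat.zero_add] at he'
      obtain rfl := H.bound_leaf_unique he he'
      obtain ⟨-, -, rfl⟩ := H.entry_unique he he'
      exact hS
  rw [h4] at key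
  obtain ⟨k', c', J', hc', hk', hJ', -⟩ := argTypes_eq_some.1 ((key [] v).1 hv)
  simp only [List.cons.injEq] at hc'
  obtain ⟨rfl, -⟩ := hc'
  refine ⟨J', hJ', ltree_ext fun c v => ?_⟩
  rw [key, argTypes_cons hk' hJ']

/-- The type of the argument has a root symbol, so `k` is a root of the sequence type of `x`;
quantitativity attributes this root to a leaf. -/
theorem leaf_of_arg (H : Contraction P C T b t t') {a : Pos} {k : ℕ} {J : Judgment}
    (ha : collapse a = b) (hk : 2 ≤ k) (hJ : P (a ++ [k]) = some J) :
    ∃ q, Entry P (a ++ [1, 0] ++ q) (binders q) k J.ty := by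
  obtain ⟨J₀, hJ₀⟩ := Option.isSome_iff_exists.1 (H.deriv.2.1 a k (by simp [hJ]))
  obtain ⟨J₁, J₂, h1, h2, h3, h4, -⟩ := H.redex_body ha hJ₀
  obtain ⟨v, hv⟩ := Option.isSome_iff_exists.1 (H.deriv.2.2 _ J hJ).1.2.2.1
  have : k ∈ roots (J₂.ctx 0) := by
    rw [h4]
    exact Option.isSome_iff_exists.2 ⟨v, by rw [argTypes_cons hk hJ, hv]⟩
  obtain ⟨q, S, he⟩ := (H.mem_roots h2 0 k).1 this
  rw [Nat.zero_add] at he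
  obtain ⟨J', hJ', rfl⟩ := H.arg_of_leaf ha he
  rw [hJ, Option.some_inj] at hJ'
  exact ⟨q, hJ' ▸ he⟩

/-- The positions of the support at or above a redex. -/
theorem above_redex (H : Contraction P C T b t t') {a γ : Pos} (ha : collapse a = b)
    (hγ : (P (a ++ γ)).isSome) : γ = [] ∨ γ = [1] ∨ (∃ γ', γ = [1, 0] ++ γ') ∨
      ∃ k γ', 2 ≤ k ∧ γ = [k] ++ γ' := by
  rcases γ with _ | ⟨k, γ⟩
  · exact Or.inl rfl
  obtain ⟨J, hJ⟩ := Option.isSome_iff_exists.1 (H.deriv.isSome_of_append _ hγ)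
  have hk : (P (a ++ [k])).isSome := H.deriv.isSome_of_append γ (by simpa using hγ)
  rcases Nat.lt_or_ge k 2 with h | h
  · interval_cases k
    · simp [(H.redex_app ha hJ).1] at hk
    · rcases γ with _ | ⟨l, γ⟩
      · exact Or.inr (Or.inl rfl)
      obtain ⟨J₁, hJ₁⟩ := Option.isSome_iff_exists.1 hk
      have hl : (P (a ++ [1] ++ [l])).isSome := H.deriv.isSome_of_append γ (by simpa using hγ)
      have h0 : l = 0 := by
        by_contra hc
        simp [-List.append_assoc, (H.redex_abs ha hJ₁).1 l hc] at hl
      subst h0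
      exact Or.inr (Or.inr (Or.inl ⟨γ, rfl⟩))
  · exact Or.inr (Or.inr (Or.inr ⟨k, γ, h, rfl⟩))

/-- The axiom leaves above a redex. -/
theorem entry_above_redex (H : Contraction P C T b t t') {a γ : Pos} {j k : ℕ} {S : TyTree}
    (ha : collapse a = b) (he : Entry P (a ++ γ) j k S) :
    (∃ γ', γ = [1, 0] ++ γ') ∨ ∃ k γ', 2 ≤ k ∧ γ = [k] ++ γ' := by
  obtain ⟨s, hs, -⟩ := id he
  have hl := he.label_eq H.proves
  rcases H.above_redex ha (by rw [hs]; rfl) with rfl | rfl | h | h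
  · rw [List.append_nil, ha, H.step.1] at hl
    cases hl
  · rw [collapse_append, ha] at hl
    have : collapse [1] = [1] := rfl
    rw [this, H.step.2.1] at hl
    cases hl
  · exact Or.inl h
  · exact Or.inr h

/-! ### Residuals -/

theorem residual_arg (H : Contraction P C T b t t') {a q α : Pos} {k : ℕ} {S : TyTree}
    {J : Judgment} (ha : collapse a = b) (he : Entry P (a ++ [1, 0] ++ q) (binders q) k S)
    (hJ : P (a ++ [k] ++ α) = some J) : Residual P b (a ++ [k] ++ α) (a ++ q ++ α)
      (liftCtx (binders q) (binders α) J.ctx) :=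
  .arg a q α k J ha (he.two_le H.deriv.axForm)
    ((isAxLeaf_iff H.deriv.axForm).2 ⟨S, by simpa using he⟩) hJ

theorem residual_cases (H : Contraction P C T b t t') {α α' : Pos} {C' : Ctx}
    (h : Residual P b α α' C') :
    (∃ a q β k S J, collapse a = b ∧ Entry P (a ++ [1, 0] ++ q) (binders q) k S ∧
      P (a ++ [k] ++ β) = some J ∧ α = a ++ [k] ++ β ∧ α' = a ++ q ++ β ∧
      C' = liftCtx (binders q) (binders β) J.ctx) ∨
    (∃ a β J, collapse a = b ∧ P (a ++ [1, 0] ++ β) = some J ∧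
      J.term [] ≠ some (.var (binders β)) ∧ α = a ++ [1, 0] ++ β ∧ α' = a ++ β ∧
      C' = bodyCtx P a (binders β) J.ctx) ∨
    ∃ J, ¬ b <+: collapse α ∧ P α = some J ∧ α' = α ∧ C' = J.ctx := by
  rcases h with ⟨a, q, α, k, J, ha, hk, hq, hJ⟩ | ⟨a, α, J, ha, hJ, hx⟩ | ⟨α, J, hb, hJ⟩
  · obtain ⟨S, he⟩ := (isAxLeaf_iff H.deriv.axForm).1 hq
    exact Or.inl ⟨a, q, α, k, S, J, ha, by simpa using he, hJ, rfl, rfl, rfl⟩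
  · exact Or.inr (Or.inl ⟨a, α, J, ha, hJ, hx, rfl, rfl, rfl⟩)
  · exact Or.inr (Or.inr ⟨J, hb, hJ, rfl, rfl⟩)

/-- This separates the residuals of body nodes from the positions occupied by plugged arguments: a
node at or above a leaf of `x` is that leaf, which is not a body residual. -/
theorem not_leaf_prefix (H : Contraction P C T b t t') {a q γ : Pos} {k : ℕ}
    {S : TyTree} {J : Judgment} (he : Entry P (a ++ q) (binders q) k S)
    (hJ : P (a ++ (q ++ γ)) = some J) (hx : J.term [] ≠ some (.var (binders (q ++ γ)))) :
    False := by
  have h0 := H.leaf_eq_of_append he (q := γ) (by rw [List.append_assoc, hJ]; rfl)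
  subst h0
  obtain ⟨s, hs, hj⟩ := he
  rw [List.append_nil, hs, Option.some_inj] at hJ
  rw [← hJ, List.append_nil] at hx
  exact hx hj

/-- This makes the choice in `reduct` unambiguous. The redex node below a position is determined by
its length, then the leaf below it by incomparability of leaves, then the argument by the axiom
track of the leaf. -/
theorem residual_unique (H : Contraction P C T b t t') {α β α' : Pos} {C' D' : Ctx}
    (h : Residual P b α α' C') (h' : Residual P b β α' D') : α = β ∧ C' = D' := by
  rcases H.residual_cases h with ⟨a, q, γ, k, S, J, ha, he, hJ, rfl, e, rfl⟩ |
      ⟨a, γ, J, ha, hJ, hx, rfl, e, rfl⟩ | ⟨J, hb, hJ, e, rfl⟩ <;>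
    rcases H.residual_cases h' with ⟨a', q', γ', k', S', J', ha', he', hJ', rfl, e', rfl⟩ |
      ⟨a', γ', J', ha', hJ', hx', rfl, e', rfl⟩ | ⟨J', hb', hJ', e', rfl⟩ <;> subst e
  · rw [List.append_assoc, List.append_assoc] at e'
    obtain ⟨rfl, e''⟩ := append_inj_of_collapse e' ha ha'
    obtain ⟨rfl, rfl⟩ := H.leaf_prefix_unique he he' e''
    obtain ⟨-, rfl, -⟩ := H.entry_unique he he'
    rw [hJ, Option.some_inj] at hJ'
    exact ⟨rfl, by rw [hJ']⟩
  · rw [List.append_assoc] at e'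
    obtain ⟨rfl, rfl⟩ := append_inj_of_collapse e' ha ha'
    exact (H.not_leaf_prefix he hJ' hx').elim
  · exact absurd (prefix_collapse_iff.2 ⟨a, q ++ γ, by rw [← e', List.append_assoc], ha⟩) hb'
  · rw [List.append_assoc] at e'
    obtain ⟨rfl, rfl⟩ := append_inj_of_collapse e' ha ha'
    exact (H.not_leaf_prefix he' hJ hx).elim
  · obtain ⟨rfl, rfl⟩ := append_inj_of_collapse e' ha ha'
    rw [hJ, Option.some_inj] at hJ'
    exact ⟨rfl, by rw [hJ']⟩
  · exact absurd (prefix_collapse_iff.2 ⟨a, γ, e'.symm, ha⟩) hb'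
  · exact absurd (prefix_collapse_iff.2 ⟨a', q' ++ γ', by rw [e', List.append_assoc], ha'⟩) hb
  · exact absurd (prefix_collapse_iff.2 ⟨a', γ', e', ha'⟩) hb
  · subst e'
    rw [hJ, Option.some_inj] at hJ'
    exact ⟨rfl, by rw [hJ']⟩

/-- Body nodes start with `1 · 0` and argument nodes with a track at least `2`, so the kind of
residual is determined; in a redex only one leaf of `x` has the track of a given argument. -/
theorem residual_functional (H : Contraction P C T b t t') {α α' β' : Pos} {C' D' : Ctx}
    (h : Residual P b α α' C') (h' : Residual P b α β' D') : α' = β' := by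
  rcases H.residual_cases h with ⟨a, q, γ, k, S, J, ha, he, hJ, e, rfl, rfl⟩ |
      ⟨a, γ, J, ha, hJ, hx, e, rfl, rfl⟩ | ⟨J, hb, hJ, rfl, rfl⟩ <;>
    rcases H.residual_cases h' with ⟨a', q', γ', k', S', J', ha', he', hJ', e', rfl, rfl⟩ |
      ⟨a', γ', J', ha', hJ', hx', e', rfl, rfl⟩ | ⟨J', hb', hJ', rfl, rfl⟩
  · rw [e, List.append_assoc, List.append_assoc] at e'
    obtain ⟨rfl, e''⟩ := append_inj_of_collapse e' ha ha'
    simp only [List.cons_append, List.nil_append, List.cons.injEq] at e''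
    obtain ⟨rfl, rfl⟩ := e''
    rw [H.bound_leaf_unique he he']
  · rw [e, List.append_assoc, List.append_assoc] at e'
    obtain ⟨rfl, e''⟩ := append_inj_of_collapse e' ha ha'
    have := he.two_le H.deriv.axForm
    simp only [List.cons_append, List.nil_append, List.cons.injEq] at e''
    omega
  · exact absurd (prefix_collapse_iff.2 ⟨a, _, by rw [e, List.append_assoc], ha⟩) hb'
  · rw [e, List.append_assoc, List.append_assoc] at e'
    obtain ⟨rfl, e''⟩ := append_inj_of_collapse e' ha ha'
    have := he'.two_le H.deriv.axForm
    simp only [List.cons_append, List.nil_append, List.cons.injEq] at e''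
    omega
  · rw [e, List.append_assoc, List.append_assoc] at e'
    obtain ⟨rfl, e''⟩ := append_inj_of_collapse e' ha ha'
    rw [List.append_cancel_left e'']
  · exact absurd (prefix_collapse_iff.2 ⟨a, _, by rw [e, List.append_assoc], ha⟩) hb'
  · exact absurd (prefix_collapse_iff.2 ⟨a', _, by rw [e', List.append_assoc], ha'⟩) hb
  · exact absurd (prefix_collapse_iff.2 ⟨a', _, by rw [e', List.append_assoc], ha'⟩) hb
  · rfl

theorem reduct_of_residual (H : Contraction P C T b t t') {α α' : Pos} {C' : Ctx}
    {J : Judgment} (h : Residual P b α α' C') (hJ : P α = some J) :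
    reduct P b t' α' = some ⟨C', sub t' (collapse α'), J.ty⟩ := by
  refine (pick_eq_some_iff ?_).2 ⟨α, C', J, h, hJ, rfl⟩
  rintro _ _ ⟨β, D, K, h1, h2, rfl⟩ ⟨β', D', K', h1', h2', rfl⟩
  obtain ⟨rfl, rfl⟩ := H.residual_unique h1 h1'
  rw [h2, Option.some_inj] at h2'
  rw [h2']

end Contraction

theorem exists_residual {P : JTree} {b : Pos} {t' : Tm} {α' : Pos} {J' : Judgment}
    (h : reduct P b t' α' = some J') : ∃ α C' J, Residual P b α α' C' ∧ P α = some J ∧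
      J' = ⟨C', sub t' (collapse α'), J.ty⟩ :=
  pick_spec (p := fun J' : Judgment => ∃ (α : Pos) (C' : Ctx) (J : Judgment), Residual P b α α' C' ∧
    P α = some J ∧ J' = ⟨C', sub t' (collapse α'), J.ty⟩) h

/-- Argument and body residuals land above `b`, so only a node that stays in place can be found
here. The comparison is made through `ctxTy` because the subterm may still change higher up. -/
theorem reduct_of_not_prefix {P : JTree} {b : Pos} {t' : Tm} {α : Pos}
    (hb : ¬ b <+: collapse α) : ctxTy (reduct P b t') α = ctxTy P α := by
  rcases hJ : P α with _ | J
  · have : reduct P b t' α = none := by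
      refine pick_eq_none (L := Judgment) fun v hv => ?_
      obtain ⟨β, C', J, hr, hβ, -⟩ := hv
      rcases hr with ⟨a, q, γ, k, J, ha, hk, hq, hJ'⟩ | ⟨a, γ, J, ha, hJ', hx⟩ | ⟨_, J, hb, hJ'⟩
      · exact hb (prefix_collapse_iff.2 ⟨a, q ++ γ, by simp, ha⟩)
      · exact hb (prefix_collapse_iff.2 ⟨a, γ, rfl, ha⟩)
      · rw [hβ] at hJ
        cases hJ
    simp [ctxTy, this, hJ]
  · obtain ⟨w, hw⟩ := pick_isSome (p := fun J' : Judgment => ∃ β C' J, Residual P b β α C' ∧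
      P β = some J ∧ J' = ⟨C', sub t' (collapse α), J.ty⟩)
      ⟨α, J.ctx, J, Residual.out α J hb hJ, hJ, rfl⟩
    obtain ⟨β, C', K, hr, hβ, rfl⟩ := pick_spec hw
    have hw' : reduct P b t' α = some ⟨C', sub t' (collapse α), K.ty⟩ := hw
    rcases hr with ⟨a, q, γ, k, J, ha, hk, hq, hJ'⟩ | ⟨a, γ, J, ha, hJ', hx⟩ | ⟨_, J, hb, hJ'⟩
    · exact absurd (prefix_collapse_iff.2 ⟨a, q ++ γ, by simp, ha⟩) hb
    · exact absurd (prefix_collapse_iff.2 ⟨a, γ, rfl, ha⟩) hb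
    · rw [hJ', Option.some_inj] at hβ hJ
      subst hβ hJ
      simp [ctxTy, hw', hJ']

namespace Contraction

variable {P : JTree} {C : Ctx} {T : TyTree} {b : Pos} {t t' : Tm}

/-! ### Labels of the contracted term -/

theorem label_body (H : Contraction P C T b t t') {a α : Pos} {l : TmLabel}
    (ha : collapse a = b) (hl : t (collapse (a ++ [1, 0] ++ α)) = some l)
    (hne : l ≠ .var (binders α)) : t' (collapse (a ++ α)) = some (lowerLabel (binders α) l) := by
  rw [collapse_append, ha, H.step.eq_subst, subst_of_ne _ (collapse α) 0 _ l
    (H.term.varLeaves.sub _)]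
  · simp
  · rw [← hl]
    simp [sub, ha]
  · simpa using hne

theorem label_arg (H : Contraction P C T b t t') {a q α : Pos} {k : ℕ} {S : TyTree}
    (ha : collapse a = b) (he : Entry P (a ++ [1, 0] ++ q) (binders q) k S) :
    t' (collapse (a ++ q ++ α)) =
      (t (collapse (a ++ [k] ++ α))).map (liftLabel (binders q) (binders α)) := by
  have hk := he.two_le H.deriv.axForm
  have hl := he.label_eq H.proves
  rw [List.append_assoc, collapse_append, ha, H.step.eq_subst, collapse_append,
    subst_var _ (collapse q) 0 _ _ (H.term.varLeaves.sub _)]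
  · have : min k 2 = 2 := by omega
    simp [lift, sub, this, ha]
  · simp only [sub, binders_collapse, Nat.zero_add]
    rw [← hl]
    simp [ha]

/-! ### Axiom leaves of the reduct -/

theorem entry_out (H : Contraction P C T b t t') {α : Pos} {j k : ℕ} {S : TyTree}
    (hb : ¬ b <+: collapse α) (h : Entry P α j k S) : Entry (reduct P b t') α j k S := by
  have hl := h.label_eq H.proves
  obtain ⟨s, hs, hj⟩ := h
  refine ⟨_, H.reduct_of_residual (.out α _ hb hs) hs, ?_⟩
  simp [sub, H.step.eq_of_not_prefix hb, hl]

theorem entry_arg (H : Contraction P C T b t t') {a q α : Pos} {j k k' : ℕ} {S S' : TyTree}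
    (ha : collapse a = b) (he : Entry P (a ++ [1, 0] ++ q) (binders q) k S)
    (h : Entry P (a ++ [k] ++ α) j k' S') : Entry (reduct P b t') (a ++ q ++ α)
      (if j < binders α then j else j + binders q) k' S' := by
  have hl := h.label_eq H.proves
  obtain ⟨s, hs, hj⟩ := h
  have := H.reduct_of_residual (H.residual_arg ha he hs) hs
  rw [liftCtx_axCtx] at this
  refine ⟨_, this, ?_⟩
  simp only [sub, List.append_nil]
  rw [H.label_arg ha he, hl]
  rfl

theorem entry_body (H : Contraction P C T b t t') {a α : Pos} {j k : ℕ} {S : TyTree}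
    (ha : collapse a = b) (h : Entry P (a ++ [1, 0] ++ α) j k S) (hne : j ≠ binders α) :
    Entry (reduct P b t') (a ++ α) (if j < binders α then j else j - 1) k S := by
  have hl := h.label_eq H.proves
  obtain ⟨s, hs, hj⟩ := h
  have := H.reduct_of_residual (.body a α _ ha hs (by simp [hj, hne])) hs
  rw [bodyCtx_axCtx P a hne] at this
  refine ⟨_, this, ?_⟩
  simp only [sub, List.append_nil]
  rw [H.label_body ha hl (by simpa using hne)]
  rfl

/-- Lifting and lowering change indices but no constructor, and the leaves of `x`, whose label would
be substituted, have no residual. So a node and its residual are subject to the same rule. -/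
theorem residual_kind (H : Contraction P C T b t t') {α α' : Pos} {C' : Ctx} {J : Judgment}
    (h : Residual P b α α' C') (hJ : P α = some J) :
    (∃ j k j', Entry P α j k J.ty ∧ Entry (reduct P b t') α' j' k J.ty) ∨
    (J.term [] = some .lam ∧ t' (collapse α') = some .lam) ∨
    (J.term [] = some .app ∧ t' (collapse α') = some .app) := by
  have hvar : ∀ j, J.term [] = some (.var j) → ∃ k, Entry P α j k J.ty := fun j hj => by
    obtain ⟨k, -, hk⟩ := H.deriv.axForm.entry hJ hj
    exact ⟨k, hk⟩
  have hkind : (∃ j, J.term [] = some (.var j)) ∨ J.term [] = some .lam ∨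
      J.term [] = some .app := by
    rcases (H.deriv.2.2 α J hJ).2 with ⟨-, i, k, h, -⟩ | ⟨-, h, -⟩ | ⟨-, h, -⟩
    · exact Or.inl ⟨i, h⟩
    · exact Or.inr (Or.inl h)
    · exact Or.inr (Or.inr h)
  have hlab := H.label_eq hJ
  rcases H.residual_cases h with ⟨a, q, γ, k, S, K, ha, he, hK, rfl, rfl, rfl⟩ |
    ⟨a, γ, K, ha, hK, hx, rfl, rfl, rfl⟩ | ⟨K, hb, hK, rfl, rfl⟩
  · rcases hkind with ⟨j, hj⟩ | hj | hj
    · obtain ⟨k', hk'⟩ := hvar j hj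
      exact Or.inl ⟨j, k', _, hk', H.entry_arg ha he hk'⟩
    · exact Or.inr (Or.inl ⟨hj, by rw [H.label_arg ha he, ← hlab, hj]; rfl⟩)
    · exact Or.inr (Or.inr ⟨hj, by rw [H.label_arg ha he, ← hlab, hj]; rfl⟩)
  · rw [hJ, Option.some_inj] at hK
    subst hK
    rcases hkind with ⟨j, hj⟩ | hj | hj
    · obtain ⟨k', hk'⟩ := hvar j hj
      exact Or.inl ⟨j, k', _, hk', H.entry_body ha hk' (by
        rintro rfl
        exact hx hj)⟩
    · exact Or.inr (Or.inl ⟨hj, by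
        rw [H.label_body ha (by rw [← hlab, hj]) (by simp)]; rfl⟩)
    · exact Or.inr (Or.inr ⟨hj, by
        rw [H.label_body ha (by rw [← hlab, hj]) (by simp)]; rfl⟩)
  · rw [H.step.eq_of_not_prefix hb, ← hlab]
    rcases hkind with ⟨j, hj⟩ | hj | hj
    · obtain ⟨k', hk'⟩ := hvar j hj
      exact Or.inl ⟨j, k', _, hk', H.entry_out hb hk'⟩
    · exact Or.inr (Or.inl ⟨hj, hj⟩)
    · exact Or.inr (Or.inr ⟨hj, hj⟩)

theorem axForm_reduct (H : Contraction P C T b t t') : AxForm (reduct P b t') := by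
  intro α' J' i hJ' hi
  obtain ⟨α, C', J, hr, hJ, rfl⟩ := exists_residual hJ'
  simp only [sub, List.append_nil] at hi
  rcases H.residual_kind hr hJ with ⟨j, k, j', he, s, hs, hs'⟩ | ⟨-, h⟩ | ⟨-, h⟩
  · have hT := he.isSome H.deriv.axForm
    have hk := he.two_le H.deriv.axForm
    rw [hJ', Option.some_inj, Judgment.mk.injEq] at hs
    obtain ⟨h1, h2, -⟩ := hs
    rw [← h2] at hs'
    simp only [sub, List.append_nil] at hs'
    rw [hi, Option.some_inj, TmLabel.var.injEq] at hs'
    exact ⟨k, hk, hs' ▸ h1, hT⟩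
  · rw [hi] at h
    cases h
  · rw [hi] at h
    cases h

theorem exists_entry_origin (H : Contraction P C T b t t') {α' : Pos} {j' k : ℕ} {S : TyTree}
    (h : Entry (reduct P b t') α' j' k S) :
    ∃ α C' j, Residual P b α α' C' ∧ Entry P α j k S := by
  obtain ⟨s, hs, hj'⟩ := id h
  obtain ⟨α, C', J, hr, hJ, e⟩ := exists_residual hs
  rw [Judgment.mk.injEq] at e
  obtain ⟨-, rfl, rfl⟩ := e
  simp only [sub, List.append_nil] at hj'
  rcases H.residual_kind hr hJ with ⟨j, k', j'', he, he'⟩ | ⟨-, h⟩ | ⟨-, h⟩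
  · obtain ⟨-, rfl, -⟩ := h.unique H.axForm_reduct he'
    exact ⟨α, C', j, hr, he⟩
  · rw [hj'] at h
    cases h
  · rw [hj'] at h
    cases h

theorem entry_reduct_cases (H : Contraction P C T b t t') {α' : Pos} {j' k : ℕ} {S : TyTree}
    (h : Entry (reduct P b t') α' j' k S) :
    (∃ a q β kk S' j, collapse a = b ∧ Entry P (a ++ [1, 0] ++ q) (binders q) kk S' ∧
      Entry P (a ++ [kk] ++ β) j k S ∧ α' = a ++ q ++ β ∧
      j' = if j < binders β then j else j + binders q) ∨
    (∃ a β j, collapse a = b ∧ Entry P (a ++ [1, 0] ++ β) j k S ∧ j ≠ binders β ∧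
      α' = a ++ β ∧ j' = if j < binders β then j else j - 1) ∨
    (¬ b <+: collapse α' ∧ Entry P α' j' k S) := by
  obtain ⟨α, C', j, hr, he⟩ := H.exists_entry_origin h
  rcases H.residual_cases hr with ⟨a, q, γ, kk, S', K, ha, hl, hK, rfl, rfl, rfl⟩ |
    ⟨a, γ, K, ha, hK, hx, rfl, rfl, rfl⟩ | ⟨K, hb, hK, rfl, rfl⟩
  · exact Or.inl ⟨a, q, γ, kk, S', j, ha, hl, he, rfl,
      (h.unique H.axForm_reduct (H.entry_arg ha hl he)).1⟩
  · have hne : j ≠ binders γ := by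
      rintro rfl
      obtain ⟨s, hs, hj⟩ := he
      rw [hK, Option.some_inj] at hs
      rw [hs] at hx
      exact hx hj
    exact Or.inr (Or.inl ⟨a, γ, j, ha, he, hne, rfl,
      (h.unique H.axForm_reduct (H.entry_body ha he hne)).1⟩)
  · refine Or.inr (Or.inr ⟨hb, ?_⟩)
    rw [(h.unique H.axForm_reduct (H.entry_out hb he)).1]
    exact he

theorem residual_of_entry_body {a β : Pos} {j k : ℕ} {S : TyTree}
    (ha : collapse a = b) (he : Entry P (a ++ [1, 0] ++ β) j k S) (hne : j ≠ binders β) :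
    ∃ C', Residual P b (a ++ [1, 0] ++ β) (a ++ β) C' := by
  obtain ⟨s, hs, hj⟩ := he
  exact ⟨_, .body a β _ ha hs (by simp [hj, hne])⟩

theorem residual_of_entry_arg (H : Contraction P C T b t t') {a q β : Pos} {j k kk : ℕ}
    {S S' : TyTree} (ha : collapse a = b)
    (hl : Entry P (a ++ [1, 0] ++ q) (binders q) kk S')
    (he : Entry P (a ++ [kk] ++ β) j k S) :
    ∃ C', Residual P b (a ++ [kk] ++ β) (a ++ q ++ β) C' := by
  obtain ⟨s, hs, hj⟩ := he
  exact ⟨_, H.residual_arg ha hl hs⟩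

/-! ### Axiom leaves above a residual -/

theorem exists_redex_above {a α γ q : Pos} (ha : collapse a = b) (hb : ¬ b <+: collapse α)
    (h : α ++ q = a ++ γ) : ∃ p, a = α ++ p ∧ q = p ++ γ := by
  rcases List.append_eq_append_iff.1 h with ⟨p, h1, h2⟩ | ⟨p, h1, -⟩
  · exact ⟨p, h1, h2⟩
  · exact absurd (prefix_collapse_iff.2 ⟨a, p, h1, ha⟩) hb

theorem out_of_entry_reduct (H : Contraction P C T b t t') {α q : Pos} {i k : ℕ} {S : TyTree}
    (hb : ¬ b <+: collapse α) (h : Entry (reduct P b t') (α ++ q) (i + binders q) k S) :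
    ∃ p C', Entry P (α ++ p) (i + binders p) k S ∧ Residual P b (α ++ p) (α ++ q) C' := by
  rcases H.entry_reduct_cases h with ⟨a, q₀, β, kk, S', j, ha, hl, he, e, ej⟩ |
    ⟨a, β, j, ha, he, hne, e, ej⟩ | ⟨hb', he⟩
  · rw [List.append_assoc] at e
    obtain ⟨p, rfl, rfl⟩ := exists_redex_above ha hb e
    obtain ⟨C', hr⟩ := H.residual_of_entry_arg ha hl he
    have hk := hl.two_le H.deriv.axForm
    -- The binders of `q₀` leave the path, which compensates the lifting of the index. The case `j <
    -- binders β` is impossible, as the variable is free at `α`, below the redex.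
    have : j = i + binders (p ++ [kk] ++ β) := by
      simp only [binders_append, binders_cons_of_ne (show kk ≠ 0 by omega), binders_nil] at ej ⊢
      split_ifs at ej <;> omega
    exact ⟨p ++ [kk] ++ β, C', by rw [← this]; simpa using he, by simpa using hr⟩
  · obtain ⟨p, rfl, rfl⟩ := exists_redex_above ha hb e
    obtain ⟨C', hr⟩ := residual_of_entry_body ha he hne
    have : j = i + binders (p ++ [1, 0] ++ β) := by
      simp only [binders_append, binders_one_cons, binders_zero_cons, binders_nil] at ej ⊢
      split_ifs at ej <;> omega
    exact ⟨p ++ [1, 0] ++ β, C', by rw [← this]; simpa using he, by simpa using hr⟩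
  · obtain ⟨s, hs, -⟩ := id he
    exact ⟨q, _, he, .out _ _ hb' hs⟩

theorem arg_of_entry_reduct (H : Contraction P C T b t t') {a q₀ α q : Pos} {i k kk : ℕ}
    {S S' : TyTree} (ha : collapse a = b)
    (hl : Entry P (a ++ [1, 0] ++ q₀) (binders q₀) kk S')
    (h : Entry (reduct P b t') (a ++ q₀ ++ α ++ q) (i + binders q) k S) :
    ∃ i₀, (i = if i₀ < binders α then i₀ else i₀ + binders q₀) ∧
      Entry P (a ++ [kk] ++ α ++ q) (i₀ + binders q) k S := by
  rcases H.entry_reduct_cases h with ⟨a', q₁, β, kk', S'', j, ha', hl', he, e, ej⟩ |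
    ⟨a', β, j, ha', he, hne, e, ej⟩ | ⟨hb', he⟩
  · simp only [List.append_assoc] at e
    obtain ⟨rfl, e₁⟩ := append_inj_of_collapse e ha ha'
    obtain ⟨rfl, rfl⟩ := H.leaf_prefix_unique hl hl' e₁
    obtain ⟨-, rfl, -⟩ := H.entry_unique hl hl'
    simp only [binders_append] at ej
    by_cases hj : j < binders α + binders q
    · rw [if_pos hj] at ej
      refine ⟨i, by rw [if_pos (by omega)], ?_⟩
      rw [ej]
      simpa using he
    · rw [if_neg hj] at ej
      refine ⟨i - binders q₀, by rw [if_neg (by omega)]; omega, ?_⟩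
      have : i - binders q₀ + binders q = j := by omega
      rw [this]
      simpa using he
  · simp only [List.append_assoc] at e
    obtain ⟨rfl, e₁⟩ := append_inj_of_collapse e ha ha'
    subst e₁
    have h0 := H.leaf_eq_of_append hl (q := α ++ q) (by simpa using he.node)
    rw [h0, List.append_nil] at he hne
    exact absurd (H.entry_unique he hl).1 hne
  · exact absurd (prefix_collapse_iff.2 ⟨a, q₀ ++ α ++ q, by simp, ha⟩) hb'

/-- Such a leaf comes either from the body or from an argument plugged at a leaf of `x` above `α`.
In the second case the variable is free in the argument, so its index must pass all the binders
between the redex and `α`. -/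
theorem body_of_entry_reduct (H : Contraction P C T b t t') {a α q : Pos} {i k : ℕ}
    {S : TyTree} (ha : collapse a = b) (hα : (P (a ++ [1, 0] ++ α)).isSome)
    (h : Entry (reduct P b t') (a ++ α ++ q) (i + binders q) k S) :
    (∃ j, Entry P (a ++ [1, 0] ++ α ++ q) (j + binders q) k S ∧ j ≠ binders α ∧
      i = if j < binders α then j else j - 1) ∨
    (∃ p γ kk S', q = p ++ γ ∧ Entry P (a ++ [1, 0] ++ α ++ p) (binders (α ++ p)) kk S' ∧
      binders α ≤ i ∧ Entry P (a ++ [kk] ++ γ) (i - binders α + binders γ) k S) := by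
  rcases H.entry_reduct_cases h with ⟨a', q₁, β, kk', S'', j, ha', hl', he, e, ej⟩ |
    ⟨a', β, j, ha', he, hne, e, ej⟩ | ⟨hb', he⟩
  · simp only [List.append_assoc] at e
    obtain ⟨rfl, e₁⟩ := append_inj_of_collapse e ha ha'
    -- The leaf of `x` cannot lie strictly below the node `α` of the body.
    have hp : ∃ p, q₁ = α ++ p ∧ q = p ++ β := by
      rcases List.append_eq_append_iff.1 e₁ with ⟨p, h1, h2⟩ | ⟨p, h1, h2⟩
      · exact ⟨p, h1, h2⟩
      · subst h1
        have h0 := H.leaf_eq_of_append hl' (q := p) (by simpa using hα)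
        subst h0
        exact ⟨[], by simp, by simpa using h2.symm⟩
    obtain ⟨p, rfl, rfl⟩ := hp
    right
    simp only [binders_append] at ej
    have hj : ¬ j < binders β := fun hj => by
      rw [if_pos hj] at ej
      omega
    rw [if_neg hj] at ej
    refine ⟨p, β, kk', S'', rfl, by simpa using hl', by omega, ?_⟩
    have : i - binders α + binders β = j := by omega
    rwa [this]
  · simp only [List.append_assoc] at e
    obtain ⟨rfl, e₁⟩ := append_inj_of_collapse e ha ha'
    subst e₁
    left
    rw [binders_append] at ej hne
    have e2 : j - binders q + binders q = j := by
      split_ifs at ej <;> omega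
    refine ⟨j - binders q, ?_, by omega, ?_⟩
    · rw [e2]
      simpa using he
    · split_ifs at ej ⊢ <;> omega
  · exact absurd (prefix_collapse_iff.2 ⟨a, α ++ q, by simp, ha⟩) hb'

theorem entry_reduct_body (H : Contraction P C T b t t') {a α q : Pos} {j k : ℕ} {S : TyTree}
    (ha : collapse a = b) (h : Entry P (a ++ [1, 0] ++ α ++ q) (j + binders q) k S)
    (hne : j ≠ binders α) :
    Entry (reduct P b t') (a ++ α ++ q) ((if j < binders α then j else j - 1) + binders q) k S := by
  have := H.entry_body ha (α := α ++ q) (by simpa using h) (by simpa using hne)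
  rw [binders_append, ← List.append_assoc] at this
  convert this using 1
  split_ifs <;> omega

theorem entry_reduct_arg (H : Contraction P C T b t t') {a q₀ α q : Pos} {j k kk : ℕ}
    {S S' : TyTree} (ha : collapse a = b)
    (hl : Entry P (a ++ [1, 0] ++ q₀) (binders q₀) kk S')
    (h : Entry P (a ++ [kk] ++ α ++ q) (j + binders q) k S) :
    Entry (reduct P b t') (a ++ q₀ ++ α ++ q)
      ((if j < binders α then j else j + binders q₀) + binders q) k S := by
  have := H.entry_arg ha hl (α := α ++ q) (by simpa using h)
  rw [binders_append, ← List.append_assoc] at this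
  convert this using 1
  split_ifs <;> omega

theorem entry_reduct_out (H : Contraction P C T b t t') {α p : Pos} {i k : ℕ} {S : TyTree}
    (hb : ¬ b <+: collapse α) (h : Entry P (α ++ p) (i + binders p) k S) :
    ∃ q, Entry (reduct P b t') (α ++ q) (i + binders q) k S := by
  by_cases hb' : b <+: collapse (α ++ p)
  · obtain ⟨a, γ, e, ha⟩ := prefix_collapse_iff.1 hb'
    obtain ⟨p₀, rfl, rfl⟩ := exists_redex_above ha hb e
    rw [e] at h
    rcases H.entry_above_redex ha h with ⟨γ, rfl⟩ | ⟨kk, γ, hk, rfl⟩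
    -- The final `1` counts the abstraction of the redex, which is crossed in `P` and disappears in
    -- the reduct.
    · have := H.entry_reduct_body (α := []) (q := γ) ha (j := i + binders p₀ + 1)
        (by simpa [Nat.add_assoc, Nat.add_comm, Nat.add_left_comm] using h) (by simp)
      exact ⟨p₀ ++ γ, by simpa [Nat.add_assoc] using this⟩
    · obtain ⟨J, hJ⟩ := Option.isSome_iff_exists.1 (H.deriv.isSome_of_append
        (a := α ++ p₀ ++ [kk]) γ (by simpa using Entry.node h))
      obtain ⟨q₀, hq₀⟩ := H.leaf_of_arg ha hk hJ
      have := H.entry_reduct_arg ha hq₀ (α := []) (q := γ) (j := i + binders p₀)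
        (by simpa [Nat.add_assoc, binders_cons_of_ne (show kk ≠ 0 by omega)] using h)
      refine ⟨p₀ ++ q₀ ++ γ, ?_⟩
      simpa [Nat.add_assoc] using this
  · exact ⟨p, H.entry_out hb' h⟩

end Contraction

/-! ### Recognising a derivation by its axiom leaves -/

theorem argTypes_congr {P R : JTree} {a α : Pos}
    (h : ∀ l, 2 ≤ l → (P (a ++ [l])).map Judgment.ty = (R (α ++ [l])).map Judgment.ty) :
    argTypes P a = argTypes R α := by
  funext c
  rcases c with _ | ⟨k, c⟩
  · rfl
  · simp only [argTypes]
    split_ifs with hk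
    · have := h k hk
      rcases h1 : P (a ++ [k]) with _ | J <;> rcases h2 : R (α ++ [k]) with _ | K <;>
        simp_all
    · rfl

theorem IsTerm001.sub {t : Tm} (h : IsTerm001 t) {a : Pos} (ha : (t a).isSome) :
    IsTerm001 (sub t a) := by
  refine ⟨h.1.sub ha, fun f hf => ?_⟩
  -- The branch `f` of the subterm is prefixed by `a`; this changes the set of its argument tracks
  -- only by a shift and finitely many elements.
  let g : ℕ → ℕ := fun n => if hn : n < a.length then a[n] else f (n - a.length)
  have hg : ∀ m, (List.range (a.length + m)).map g = a ++ (List.range m).map f := by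
    intro m
    refine List.ext_getElem (by simp) fun i h1 h2 => ?_
    rw [List.getElem_map, List.getElem_range, List.getElem_append]
    by_cases hi : i < a.length
    · simp [g, hi]
    · simp [g, hi]
  have hinf := h.2 g (fun n => by
    refine h.1.isSome_of_append (((List.range (a.length + n)).map g).drop n) ?_
    have : (List.range n).map g = ((List.range (a.length + n)).map g).take n := by
      rw [← List.map_take, List.take_range, min_eq_left (by omega)]
    rw [this, List.take_append_drop, hg]
    exact hf n)
  intro hfin
  apply hinf
  refine ((Set.finite_lt_nat a.length).union (hfin.image (· + a.length))).subset ?_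
  intro i hi
  by_cases hlt : i < a.length
  · exact Or.inl hlt
  · refine Or.inr ⟨i - a.length, ?_, by simp; omega⟩
    have h2 : 2 ≤ g i := hi
    simpa [g, hlt] using h2

/-- A labelled tree whose contexts are given by its axiom leaves is a derivation, as soon as
the types are correct for the rules, and as the axiom leaves of a variable have different
axiom tracks. -/
theorem isDerivation_of_quantitative {R : JTree} {t : Tm} (hroot : (R []).isSome)
    (hpre : ∀ a k, (R (a ++ [k])).isSome → (R a).isSome)
    (hterm : ∀ a J, R a = some J → J.term = sub t (collapse a))
    (hW : ∀ a J, R a = some J → IsTerm001 J.term ∧ IsTy J.ty)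
    (hax : AxForm R) (hquant : Quantitative R)
    (huniq : ∀ a q q' i k S S', Entry R (a ++ q) (i + binders q) k S →
      Entry R (a ++ q') (i + binders q') k S' → q = q')
    (hrule : ∀ a J, R a = some J →
      ((∃ i, J.term [] = some (.var i)) ∧ ∀ l, R (a ++ [l]) = none) ∨
      (J.term [] = some .lam ∧ (∀ l, l ≠ 0 → R (a ++ [l]) = none) ∧
        ∃ J₀, R (a ++ [0]) = some J₀ ∧ J.ty = arrow (J₀.ctx 0) J₀.ty) ∨
      (J.term [] = some .app ∧ R (a ++ [0]) = none ∧
        ∃ J₁, R (a ++ [1]) = some J₁ ∧ J₁.ty = arrow (argTypes R a) J.ty)) :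
    IsDerivation R := by
  have hQ := (quantitative_iff hax).1 hquant
  have hsub : ∀ {a J}, R a = some J → ∀ {l K}, R (a ++ [l]) = some K →
      K.term = sub J.term [min l 2] := by
    intro a J hJ l K hK
    rw [hterm _ _ hK, hterm _ _ hJ]
    funext p
    simp [sub]
  have hpre' : ∀ a q, (R (a ++ q)).isSome → (R a).isSome := by
    intro a q hq
    induction q using List.reverseRecOn with
    | nil => simpa using hq
    | append_singleton q k ih =>
      rw [← List.append_assoc] at hq
      exact ih (hpre _ _ hq)
  refine ⟨hroot, hpre, fun a J hJ => ⟨⟨fun i => ⟨?_, ?_, ?_⟩, hW a J hJ⟩, ?_⟩⟩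
  · rw [Option.eq_none_iff_forall_ne_some]
    intro v hv
    obtain ⟨q, k, S, -, hs⟩ := (hQ a J hJ i [] v).1 hv
    simp [single] at hs
  · intro k c hk
    rw [Option.eq_none_iff_forall_ne_some]
    intro v hv
    obtain ⟨q, k', S, he, hs⟩ := (hQ a J hJ i _ v).1 hv
    obtain ⟨c', hc', -⟩ := single_eq_some.1 hs
    simp only [List.cons.injEq] at hc'
    have := he.two_le hax
    omega
  · intro k hk
    by_cases h : ∃ q S, Entry R (a ++ q) (i + binders q) k S
    · obtain ⟨q, S, he⟩ := h
      right
      -- Since a single leaf contributes to the track `k`, the component of the context is the type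
      -- of this leaf and not an overlay of several types.
      have : (fun c => J.ctx i (k :: c)) = S := by
        refine ltree_ext fun c v => ?_
        rw [hQ a J hJ]
        constructor
        · rintro ⟨q', k', S', he', hs⟩
          obtain ⟨c', hc', hv⟩ := single_eq_some.1 hs
          simp only [List.cons.injEq] at hc'
          obtain ⟨rfl, rfl⟩ := hc'
          obtain rfl := huniq _ _ _ _ _ _ _ he he'
          obtain ⟨-, -, rfl⟩ := he.unique hax he'
          exact hv
        · intro hv
          exact ⟨q, k, S, he, by rwa [single_self]⟩
      rw [this]
      obtain ⟨s, hs, -⟩ := he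
      exact (hW _ _ hs).2
    · left
      intro c
      rw [Option.eq_none_iff_forall_ne_some]
      intro v hv
      obtain ⟨q, k', S, he, hs⟩ := (hQ a J hJ i _ v).1 hv
      obtain ⟨c', hc', -⟩ := single_eq_some.1 hs
      simp only [List.cons.injEq] at hc'
      obtain ⟨rfl, -⟩ := hc'
      exact h ⟨q, S, he⟩
  · rcases hrule a J hJ with ⟨⟨i, hi⟩, h0⟩ | ⟨hl, h0, J₀, hJ₀, hty⟩ | ⟨hl, h0, J₁, hJ₁, hty⟩
    · obtain ⟨k, hk, hc, -⟩ := hax a J i hJ hi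
      exact Or.inl ⟨h0, i, k, hi, hk, hc⟩
    · refine Or.inr (Or.inl ⟨h0, hl, J₀, hJ₀, by simpa using hsub hJ hJ₀, ?_, hty⟩)
      funext i
      refine ltree_ext fun c v => ?_
      rw [hQ a J hJ, hQ _ J₀ hJ₀]
      constructor
      · rintro ⟨q, k, S, he, hs⟩
        rcases q with _ | ⟨l, q⟩
        · obtain ⟨s, hs', hj⟩ := he
          rw [List.append_nil, hJ, Option.some_inj] at hs'
          rw [hs'] at hl
          exact absurd (hj.symm.trans hl) (by simp)
        · have : l = 0 := by
            by_contra hc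
            have := hpre' (a ++ [l]) q (by simpa using he.node)
            simp [h0 l hc] at this
          subst this
          exact ⟨q, k, S, by simpa [Nat.add_assoc, Nat.add_comm] using he, hs⟩
      · rintro ⟨q, k, S, he, hs⟩
        exact ⟨0 :: q, k, S, by simpa [Nat.add_assoc, Nat.add_comm] using he, hs⟩
    · have hsplit : ∀ i k S, (∃ q, Entry R (a ++ q) (i + binders q) k S) ↔
          ∃ l q, l ≠ 0 ∧ Entry R (a ++ [l] ++ q) (i + binders q) k S := by
        intro i k S
        constructor
        · rintro ⟨q, he⟩
          rcases q with _ | ⟨l, q⟩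
          · obtain ⟨s, hs', hj⟩ := he
            rw [List.append_nil, hJ, Option.some_inj] at hs'
            rw [hs'] at hl
            exact absurd (hj.symm.trans hl) (by simp)
          · have hl0 : l ≠ 0 := by
              rintro rfl
              have := hpre' (a ++ [0]) q (by simpa using he.node)
              simp [h0] at this
            exact ⟨l, q, hl0, by simpa [binders_cons_of_ne hl0] using he⟩
        · rintro ⟨l, q, hl0, he⟩
          exact ⟨l :: q, by simpa [binders_cons_of_ne hl0] using he⟩
      have hchild : ∀ {l i c v}, ctxAt R (a ++ [l]) i c = some v → ∃ q k S c', l ≠ 0 ∧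
          Entry R (a ++ l :: q) (i + binders (l :: q)) k S ∧ c = k :: c' ∧ S c' = some v := by
        intro l i c v h
        obtain ⟨K, hK, hc⟩ := ctxAt_eq_some.1 h
        have hl0 : l ≠ 0 := by
          rintro rfl
          simp [h0] at hK
        obtain ⟨q, k, S, he, hs⟩ := (hQ _ K hK i c v).1 hc
        obtain ⟨c', hc', hv⟩ := single_eq_some.1 hs
        exact ⟨q, k, S, c', hl0, by simpa [binders_cons_of_ne hl0] using he, hc', hv⟩
      refine Or.inr (Or.inr ⟨h0, hl, ⟨J₁, hJ₁, by simpa using hsub hJ hJ₁, hty⟩, ?_, ?_⟩)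
      · intro k J' hk hJ'
        simpa [hk] using hsub hJ hJ'
      · intro i
        refine ⟨?_, ?_⟩
        -- A track common to the contexts of two premises would come from two leaves above `a`, one
        -- through `l` and one through `l'`; these must be equal.
        · intro l l' hll
          rw [Set.disjoint_left]
          intro k hk hk'
          obtain ⟨v, hv⟩ := Option.isSome_iff_exists.1 hk
          obtain ⟨v', hv'⟩ := Option.isSome_iff_exists.1 hk'
          obtain ⟨q, k1, S, c, -, he, hc, -⟩ := hchild hv
          obtain ⟨q', k2, S', c', -, he', hc', -⟩ := hchild hv'
          simp only [List.cons.injEq] at hc hc'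
          obtain ⟨rfl, -⟩ := hc
          obtain ⟨rfl, -⟩ := hc'
          have := huniq _ _ _ _ _ _ _ he he'
          simp only [List.cons.injEq] at this
          exact hll this.1
        · refine ltree_ext fun c v => ?_
          rw [join_eq_some, hQ a J hJ]
          · constructor
            · rintro ⟨q, k, S, he, hs⟩
              obtain ⟨l, q, hl0, he⟩ := (hsplit i k S).1 ⟨q, he⟩
              obtain ⟨K, hK⟩ := Option.isSome_iff_exists.1 (hpre' _ _ he.node)
              exact ⟨l, ctxAt_eq_some.2 ⟨K, hK, (hQ _ K hK i c v).2 ⟨q, k, S, he, hs⟩⟩⟩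
            · rintro ⟨l, h⟩
              obtain ⟨q, k, S, c', -, he, rfl, hv⟩ := hchild h
              exact ⟨l :: q, k, S, he, by rwa [single_self]⟩
          · intro l l' u w h h'
            obtain ⟨q, k, S, c, -, he, hc, hv⟩ := hchild h
            obtain ⟨q', k', S', c', -, he', hc', hv'⟩ := hchild h'
            rw [hc, List.cons.injEq] at hc'
            obtain ⟨rfl, rfl⟩ := hc'
            have hq := huniq _ _ _ _ _ _ _ he he'
            rw [← hq] at he'
            obtain ⟨-, -, rfl⟩ := he.unique hax he'
            rw [hv] at hv'
            exact Option.some_inj.1 hv'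

/-! ### Contexts of the reduct -/

namespace Contraction

variable {P : JTree} {C : Ctx} {T : TyTree} {b : Pos} {t t' : Tm}

open Classical in
/-- The families that are joined by `bodyCtx` do not overlap. -/
theorem bodyCtx_eq_some (H : Contraction P C T b t t') {a α : Pos} {J : Judgment}
    (hJ : P (a ++ [1, 0] ++ α) = some J) {i : ℕ} (hi : binders α ≤ i)
    {c : Pos} {v : TyLabel} : bodyCtx P a (binders α) J.ctx i c = some v ↔
      J.ctx (i + 1) c = some v ∨
        ∃ k ∈ roots (J.ctx (binders α)), ctxAt P (a ++ [k]) (i - binders α) c = some v := by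
  unfold bodyCtx
  rw [if_neg (by omega), join_eq_some]
  · constructor
    · rintro ⟨_ | k, h⟩
      · exact Or.inl h
      · simp only at h
        split_ifs at h with hk
        · exact Or.inr ⟨k, hk, h⟩
        · simp [emptyTree] at h
    · rintro (h | ⟨k, hk, h⟩)
      · exact ⟨none, h⟩
      · exact ⟨some k, by simpa only [if_pos hk] using h⟩
  -- Every summand, from the body or from an argument, comes from leaves above the redex node `a`
  -- that type the one index `i - binders α`. Uniqueness of leaves at `a` then prevents overlaps.
  · have key : ∀ (l : Option ℕ) (u : TyLabel), (match l with
        | none => J.ctx (i + 1)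
        | some k => if k ∈ roots (J.ctx (binders α)) then ctxAt P (a ++ [k]) (i - binders α)
          else emptyTree) c = some u → ∃ p k S c', c = k :: c' ∧ S c' = some u ∧
            Entry P (a ++ p) (i - binders α + binders p) k S := by
      rintro (_ | k) u h
      · obtain ⟨q, k, S, he, hs⟩ := (H.ctx_iff hJ (i + 1) c u).1 h
        obtain ⟨c', hc', hv⟩ := single_eq_some.1 hs
        refine ⟨[1, 0] ++ α ++ q, k, S, c', hc', hv, ?_⟩
        have e : i - binders α + binders ([1, 0] ++ α ++ q) = i + 1 + binders q := by
          simp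
          omega
        rw [e]
        simpa using he
      · simp only at h
        split_ifs at h with hk
        · obtain ⟨K, hK, hc⟩ := ctxAt_eq_some.1 h
          obtain ⟨q₀, S₀, h₀⟩ := (H.mem_roots hJ _ _).1 hk
          have hk2 := h₀.two_le H.deriv.axForm
          obtain ⟨q, k', S, he, hs⟩ := (H.ctx_iff hK _ c u).1 hc
          obtain ⟨c', hc', hv⟩ := single_eq_some.1 hs
          exact ⟨k :: q, k', S, c', hc', hv, by
            simpa [binders_cons_of_ne (show k ≠ 0 by omega)] using he⟩
        · simp [emptyTree] at h
    intro l l' u w h h'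
    obtain ⟨p, k, S, c', hc, hv, he⟩ := key l u h
    obtain ⟨p', k', S', c'', hc', hv', he'⟩ := key l' w h'
    rw [hc, List.cons.injEq] at hc'
    obtain ⟨rfl, rfl⟩ := hc'
    obtain rfl := H.leaf_unique he he'
    obtain ⟨-, -, rfl⟩ := H.entry_unique he he'
    rw [hv] at hv'
    exact Option.some_inj.1 hv'

/-- The residual contexts are defined so as to follow the leaves. Above an argument residual the
leaves are merely relocated; above a body residual, leaves of `x` are exchanged for the leaves of
the plugged arguments; at a node that stays, paths through redexes are rerouted with the same tracks
and types. -/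
theorem quantitative_reduct (H : Contraction P C T b t t') : Quantitative (reduct P b t') := by
  rw [quantitative_iff H.axForm_reduct]
  intro α' J' hJ' i c v
  obtain ⟨α, C', J, hr, hJ, rfl⟩ := exists_residual hJ'
  rcases H.residual_cases hr with ⟨a, q₀, γ, kk, S₀, K, ha, hl, hK, rfl, rfl, rfl⟩ |
    ⟨a, γ, K, ha, hK, hx, rfl, rfl, rfl⟩ | ⟨K, hb, hK, rfl, rfl⟩
  · have h1 : liftCtx (binders q₀) (binders γ) K.ctx i c = some v ↔ ∃ i₀,
        (i = if i₀ < binders γ then i₀ else i₀ + binders q₀) ∧ K.ctx i₀ c = some v := by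
      unfold liftCtx
      split_ifs with h h'
      · constructor
        · exact fun h' => ⟨i, by simp [h], h'⟩
        · rintro ⟨i₀, e, h'⟩
          split_ifs at e <;> first | omega | rwa [e]
      · constructor
        · intro h
          simp [emptyTree] at h
        · rintro ⟨i₀, e, -⟩
          split_ifs at e <;> omega
      · constructor
        · exact fun h => ⟨i - binders q₀, by split_ifs <;> omega, h⟩
        · rintro ⟨i₀, e, h1⟩
          have : i - binders q₀ = i₀ := by
            split_ifs at e <;> omega
          rwa [this]
    rw [h1]
    constructor
    · rintro ⟨i₀, rfl, h⟩
      obtain ⟨q, k, S, he, hs⟩ := (H.ctx_iff hK i₀ c v).1 h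
      exact ⟨q, k, S, H.entry_reduct_arg ha hl he, hs⟩
    · rintro ⟨q, k, S, he, hs⟩
      obtain ⟨i₀, e, he'⟩ := H.arg_of_entry_reduct ha hl he
      exact ⟨i₀, e, (H.ctx_iff hK i₀ c v).2 ⟨q, k, S, he', hs⟩⟩
  · rcases Nat.lt_or_ge i (binders γ) with hi | hi
    · have h1 : bodyCtx P a (binders γ) K.ctx i = K.ctx i := by
        simp [bodyCtx, hi]
      simp only [h1]
      rw [H.ctx_iff hK]
      constructor
      · rintro ⟨q, k, S, he, hs⟩
        have := H.entry_reduct_body ha he (by omega)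
        rw [if_pos hi] at this
        exact ⟨q, k, S, this, hs⟩
      · rintro ⟨q, k, S, he, hs⟩
        rcases H.body_of_entry_reduct ha (by rw [hK]; rfl) he with ⟨j, he', hne, e⟩ |
          ⟨p, γ', kk, S', -, -, hle, -⟩
        · have : j = i := by
            split_ifs at e <;> omega
          exact ⟨q, k, S, this ▸ he', hs⟩
        · omega
    · rw [H.bodyCtx_eq_some hK hi, H.ctx_iff hK]
      constructor
      · rintro (⟨q, k, S, he, hs⟩ | ⟨kk, hkk, h⟩)
        · have := H.entry_reduct_body ha he (by omega)
          rw [if_neg (by omega)] at this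
          exact ⟨q, k, S, by simpa using this, hs⟩
        · obtain ⟨p, S', hl⟩ := (H.mem_roots hK _ _).1 hkk
          obtain ⟨K', hK', h⟩ := ctxAt_eq_some.1 h
          obtain ⟨q, k, S, he, hs⟩ := (H.ctx_iff hK' _ c v).1 h
          -- The leaf of `x` with track `kk` is at `γ ++ p` in the body, so the whole argument
          -- derivation is moved there.
          have := H.entry_reduct_arg (q₀ := γ ++ p) (α := []) (q := q) (j := i - binders γ) ha
            (by simpa using hl) (by simpa using he)
          refine ⟨p ++ q, k, S, ?_, hs⟩
          have e : (if i - binders γ < binders [] then i - binders γ else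
              i - binders γ + binders (γ ++ p)) + binders q = i + binders (p ++ q) := by
            simp
            omega
          rw [e] at this
          simpa using this
      · rintro ⟨q, k, S, he, hs⟩
        rcases H.body_of_entry_reduct ha (by rw [hK]; rfl) he with ⟨j, he', hne, e⟩ |
          ⟨p, γ', kk, S', rfl, hl, hle, he'⟩
        · left
          have : j = i + 1 := by
            split_ifs at e <;> omega
          exact ⟨q, k, S, this ▸ he', hs⟩
        · right
          refine ⟨kk, (H.mem_roots hK _ _).2 ⟨p, S', by simpa using hl⟩, ?_⟩
          obtain ⟨K', hK'⟩ := Option.isSome_iff_exists.1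
            (H.deriv.isSome_of_append (a := a ++ [kk]) γ' (by simpa using he'.node))
          exact ctxAt_eq_some.2 ⟨K', hK', (H.ctx_iff hK' _ c v).2 ⟨γ', k, S, he', hs⟩⟩
  · rw [hJ, Option.some_inj] at hK
    subst hK
    rw [H.ctx_iff hJ]
    constructor
    · rintro ⟨p, k, S, he, hs⟩
      obtain ⟨q, he'⟩ := H.entry_reduct_out hb he
      exact ⟨q, k, S, he', hs⟩
    · rintro ⟨q, k, S, he, hs⟩
      obtain ⟨p, -, he', -⟩ := H.out_of_entry_reduct hb he
      exact ⟨p, k, S, he', hs⟩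

/-- The axiom leaves of the reduct above a given position that type a given variable come from
axiom leaves that type a same variable. -/
theorem exists_origin_of_leaves (H : Contraction P C T b t t') {α' : Pos}
    (hα' : (reduct P b t' α').isSome) (i : ℕ) : ∃ β i₀, ∀ q k S,
      Entry (reduct P b t') (α' ++ q) (i + binders q) k S →
        ∃ p C', Entry P (β ++ p) (i₀ + binders p) k S ∧ Residual P b (β ++ p) (α' ++ q) C' := by
  obtain ⟨J', hJ'⟩ := Option.isSome_iff_exists.1 hα'
  obtain ⟨α, C', J, hr, hJ, rfl⟩ := exists_residual hJ'
  rcases H.residual_cases hr with ⟨a, q₀, γ, kk, S₀, K, ha, hl, hK, rfl, rfl, rfl⟩ |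
    ⟨a, γ, K, ha, hK, hx, rfl, rfl, rfl⟩ | ⟨K, hb, hK, rfl, rfl⟩
  · refine ⟨a ++ [kk] ++ γ, if i < binders γ then i else i - binders q₀, fun q k S he => ?_⟩
    obtain ⟨i₀, e, he'⟩ := H.arg_of_entry_reduct ha hl he
    obtain ⟨C', hr'⟩ := H.residual_of_entry_arg ha hl (β := γ ++ q) (by simpa using he')
    refine ⟨q, C', ?_, by simpa using hr'⟩
    have : (if i < binders γ then i else i - binders q₀) = i₀ := by
      split_ifs at e ⊢ <;> omega
    rwa [this]
  · rcases Nat.lt_or_ge i (binders γ) with hi | hi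
    · refine ⟨a ++ [1, 0] ++ γ, i, fun q k S he => ?_⟩
      rcases H.body_of_entry_reduct ha (by rw [hK]; rfl) he with ⟨j, he', hne, e⟩ |
        ⟨p, γ', kk, S', -, -, hle, -⟩
      · obtain ⟨C', hr'⟩ := residual_of_entry_body ha (β := γ ++ q) (by simpa using he')
          (by simpa using hne)
        have : j = i := by
          split_ifs at e <;> omega
        exact ⟨q, C', this ▸ he', by simpa using hr'⟩
      · omega
    -- A variable free in the redex can be typed both in the body and in the plugged arguments. The
    -- common origin is therefore the redex node, not the body node.
    · refine ⟨a, i - binders γ, fun q k S he => ?_⟩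
      rcases H.body_of_entry_reduct ha (by rw [hK]; rfl) he with ⟨j, he', hne, e⟩ |
        ⟨p, γ', kk, S', rfl, hl, hle, he'⟩
      · obtain ⟨C', hr'⟩ := residual_of_entry_body ha (β := γ ++ q) (by simpa using he')
          (by simpa using hne)
        have e1 : i - binders γ + binders ([1, 0] ++ γ ++ q) = j + binders q := by
          simp
          split_ifs at e <;> omega
        exact ⟨[1, 0] ++ γ ++ q, C', by rw [e1]; simpa using he', by simpa using hr'⟩
      · have hk2 := hl.two_le H.deriv.axForm
        obtain ⟨C', hr'⟩ := H.residual_of_entry_arg ha (q := γ ++ p) (by simpa using hl) he'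
        exact ⟨[kk] ++ γ', C', by
          simpa [binders_cons_of_ne (show kk ≠ 0 by omega)] using he', by simpa using hr'⟩
  · exact ⟨α', i, fun q k S he => H.out_of_entry_reduct hb he⟩

/-! ### Nodes of the reduct -/

/-- At a leaf of `x` the position is taken over by the root of its argument derivation, which has
the same type. The clause on index `0` serves the abstraction rule; at such a leaf below a binder
both contexts are empty there. -/
theorem reduct_body (H : Contraction P C T b t t') {a β : Pos} {K : Judgment}
    (ha : collapse a = b) (hK : P (a ++ [1, 0] ++ β) = some K) :
    ∃ K', reduct P b t' (a ++ β) = some K' ∧ K'.ty = K.ty ∧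
      (0 < binders β → K'.ctx 0 = K.ctx 0) := by
  by_cases hx : K.term [] = some (.var (binders β))
  · obtain ⟨k, hk, he⟩ := H.deriv.axForm.entry hK hx
    obtain ⟨L, hL, hty⟩ := H.arg_of_leaf ha he
    have := H.reduct_of_residual (H.residual_arg ha he (α := []) (by simpa using hL))
      (by simpa using hL)
    rw [List.append_nil] at this
    refine ⟨_, this, hty, fun h => ?_⟩
    obtain ⟨s, hs, -⟩ := he
    rw [hK, Option.some_inj] at hs
    rw [hs]
    simp only
    rw [axCtx_of_ne (by omega)]
    simp [liftCtx, h]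
  · refine ⟨_, H.reduct_of_residual (.body a β K ha hK hx) hK, rfl, fun h => ?_⟩
    simp [bodyCtx, h]

/-- The redex node has no residual: its place goes to the root of the body, or of an argument if the
body is `x`. Comparing the contexts through their leaves treats both cases at once. -/
theorem reduct_redex (H : Contraction P C T b t t') {a : Pos} {K : Judgment}
    (ha : collapse a = b) (hK : P a = some K) :
    ∃ K', reduct P b t' a = some K' ∧ K'.ty = K.ty ∧ K'.ctx = K.ctx := by
  obtain ⟨J₁, J₂, h1, h2, h3, -⟩ := H.redex_body ha hK
  obtain ⟨K', hK', hty, -⟩ := H.reduct_body (β := []) ha (by simpa using h2)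
  rw [List.append_nil] at hK'
  refine ⟨K', hK', hty.trans h3, funext fun i => ltree_ext fun c v => ?_⟩
  rw [(quantitative_iff H.axForm_reduct).1 H.quantitative_reduct a K' hK', H.ctx_iff hK]
  constructor
  · rintro ⟨q, k, S, he, hs⟩
    rcases H.body_of_entry_reduct (α := []) ha (by simp [h2]) (by simpa using he) with
      ⟨j, he', hne, e⟩ | ⟨p, γ', kk, S', -, hl, -, he'⟩
    · simp only [binders_nil] at hne e
      refine ⟨[1, 0] ++ q, k, S, ?_, hs⟩
      have e1 : i + binders ([1, 0] ++ q) = j + binders q := by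
        simp at e ⊢
        omega
      rw [e1]
      simpa using he'
    · have hk2 := hl.two_le H.deriv.axForm
      exact ⟨kk :: γ', k, S, by
        simpa [binders_cons_of_ne (show kk ≠ 0 by omega)] using he', hs⟩
  · rintro ⟨p, k, S, he, hs⟩
    rcases H.entry_above_redex ha he with ⟨γ, rfl⟩ | ⟨kk, γ, hk, rfl⟩
    · have := H.entry_reduct_body (α := []) (q := γ) ha (j := i + 1)
        (by simpa [Nat.add_assoc, Nat.add_comm] using he) (by simp)
      exact ⟨γ, k, S, by simpa using this, hs⟩
    · obtain ⟨J, hJ⟩ := Option.isSome_iff_exists.1 (H.deriv.isSome_of_append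
        (a := a ++ [kk]) γ (by simpa using he.node))
      obtain ⟨q₀, hq₀⟩ := H.leaf_of_arg ha hk hJ
      have := H.entry_reduct_arg ha hq₀ (α := []) (q := γ) (j := i)
        (by simpa [binders_cons_of_ne (show kk ≠ 0 by omega)] using he)
      exact ⟨q₀ ++ γ, k, S, by simpa [Nat.add_assoc] using this, hs⟩

theorem reduct_out (H : Contraction P C T b t t') {α : Pos} {K : Judgment}
    (hb : ¬ b <+: collapse α) (hK : P α = some K) :
    ∃ K', reduct P b t' α = some K' ∧ K'.ty = K.ty ∧ K'.ctx = K.ctx :=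
  ⟨_, H.reduct_of_residual (.out α K hb hK) hK, rfl, rfl⟩

theorem not_prefix_of_collapse_concat {α : Pos} {l : ℕ} (h : collapse (α ++ [l]) = b) :
    ¬ b <+: collapse α := by
  intro hp
  have h1 := hp.length_le
  have h2 := congrArg List.length h
  simp only [length_collapse, List.length_append, List.length_singleton] at h1 h2
  omega

theorem reduct_isSome_of_concat (H : Contraction P C T b t t') {α' : Pos} {l : ℕ}
    (h : (reduct P b t' (α' ++ [l])).isSome) : (reduct P b t' α').isSome := by
  have hout : ∀ a, a = α' ++ [l] → collapse a = b → (P a).isSome →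
      (reduct P b t' α').isSome := by
    rintro a rfl ha hP
    obtain ⟨K, hK⟩ := Option.isSome_iff_exists.1 (H.deriv.2.1 _ _ hP)
    obtain ⟨K', hK', -⟩ := H.reduct_out (not_prefix_of_collapse_concat ha) hK
    rw [hK']
    rfl
  have hbody : ∀ a β, collapse a = b → a ++ β = α' ++ [l] → (P (a ++ [1, 0] ++ β)).isSome →
      (reduct P b t' α').isSome := by
    intro a β ha e hP
    rcases List.eq_nil_or_concat' β with rfl | ⟨β, l', rfl⟩
    · exact hout a (by simpa using e) ha (H.deriv.isSome_of_append [1, 0] (by simpa using hP))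
    · rw [← List.append_assoc] at e
      obtain ⟨rfl, -⟩ := List.append_inj' e rfl
      obtain ⟨K, hK⟩ := Option.isSome_iff_exists.1
        (H.deriv.2.1 (a ++ [1, 0] ++ β) l' (by simpa using hP))
      obtain ⟨K', hK', -⟩ := H.reduct_body ha hK
      rw [hK']
      rfl
  obtain ⟨J', hJ'⟩ := Option.isSome_iff_exists.1 h
  obtain ⟨α, C', J, hr, hJ, rfl⟩ := exists_residual hJ'
  rcases H.residual_cases hr with ⟨a, q₀, γ, kk, S₀, K, ha, hl, hK, rfl, e, rfl⟩ |
    ⟨a, γ, K, ha, hK, hx, rfl, e, rfl⟩ | ⟨K, hb, hK, rfl, rfl⟩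
  -- The root of an argument has as its new parent the parent of the leaf that it replaces.
  · rcases List.eq_nil_or_concat' γ with rfl | ⟨γ, l', rfl⟩
    · exact hbody a q₀ ha (by simpa using e.symm) hl.node
    · rw [← List.append_assoc] at e
      obtain ⟨rfl, -⟩ := List.append_inj' e rfl
      obtain ⟨K, hK⟩ := Option.isSome_iff_exists.1
        (H.deriv.2.1 (a ++ [kk] ++ γ) l' (by rw [List.append_assoc, hK]; rfl))
      rw [H.reduct_of_residual (H.residual_arg ha hl hK) hK]
      rfl
  · exact hbody a γ ha e.symm (by rw [hK]; rfl)
  · obtain ⟨K, hK⟩ := Option.isSome_iff_exists.1 (H.deriv.2.1 _ _ (by rw [hJ]; rfl))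
    obtain ⟨K', hK', -⟩ := H.reduct_out (fun hp => hb (by
      rw [collapse_append]
      exact hp.trans (List.prefix_append _ _))) hK
    rw [hK']
    rfl

/-- Residuals commute with passing to a premise except at two seams, where a premise is a leaf of
`x` or the redex itself. There the replacing node has the same type, and agrees on index `0` when
the premise is that of an abstraction. -/
theorem reduct_child (H : Contraction P C T b t t') {α α' : Pos} {C' : Ctx} {J K : Judgment}
    {l : ℕ} (hr : Residual P b α α' C') (hJ : P α = some J) (hK : P (α ++ [l]) = some K) :
    ∃ K', reduct P b t' (α' ++ [l]) = some K' ∧ K'.ty = K.ty ∧ (l = 0 → K'.ctx 0 = K.ctx 0) := by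
  rcases H.residual_cases hr with ⟨a, q₀, γ, kk, S₀, K₀, ha, hl, hK₀, rfl, rfl, rfl⟩ |
    ⟨a, γ, K₀, ha, hK₀, hx, rfl, rfl, rfl⟩ | ⟨K₀, hb, hK₀, rfl, rfl⟩
  · rw [List.append_assoc] at hK
    rw [List.append_assoc]
    refine ⟨_, H.reduct_of_residual (H.residual_arg ha hl hK) hK, rfl, ?_⟩
    rintro rfl
    simp [liftCtx]
  · rw [List.append_assoc] at hK
    obtain ⟨K', hK', hty, hc⟩ := H.reduct_body ha hK
    refine ⟨K', by simpa using hK', hty, ?_⟩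
    rintro rfl
    exact hc (by simp)
  · by_cases hb' : b <+: collapse (α' ++ [l])
    · obtain ⟨a, γ, e, ha⟩ := prefix_collapse_iff.1 hb'
      have hγ : γ = [] := by
        rcases List.eq_nil_or_concat' γ with rfl | ⟨γ, l', rfl⟩
        · rfl
        · rw [← List.append_assoc] at e
          obtain ⟨rfl, -⟩ := List.append_inj' e rfl
          exact absurd (prefix_collapse_iff.2 ⟨a, γ, rfl, ha⟩) hb
      rw [hγ, List.append_nil] at e
      subst e
      obtain ⟨K', hK', hty, hc⟩ := H.reduct_redex ha hK
      exact ⟨K', hK', hty, fun _ => by rw [hc]⟩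
    · obtain ⟨K', hK', hty, hc⟩ := H.reduct_out hb' hK
      exact ⟨K', hK', hty, fun _ => by rw [hc]⟩

theorem isSome_of_reduct_child (H : Contraction P C T b t t') {α α' : Pos} {C' : Ctx}
    {l : ℕ} (hr : Residual P b α α' C')
    (h : (reduct P b t' (α' ++ [l])).isSome) : (P (α ++ [l])).isSome := by
  obtain ⟨L', hL'⟩ := Option.isSome_iff_exists.1 h
  obtain ⟨β, D', L, hr', hL, rfl⟩ := exists_residual hL'
  rcases H.residual_cases hr with ⟨a, q₀, γ, kk, S₀, K₀, ha, hl, hK₀, rfl, rfl, rfl⟩ |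
    ⟨a, γ, K₀, ha, hK₀, hx, rfl, rfl, rfl⟩ | ⟨K₀, hb, hK₀, rfl, rfl⟩ <;>
  rcases H.residual_cases hr' with ⟨a', q₁, γ', kk', S₁, K₁, ha', hl', hK₁, rfl, e, rfl⟩ |
    ⟨a', γ', K₁, ha', hK₁, hx', rfl, e, rfl⟩ | ⟨K₁, hb', hK₁, rfl, rfl⟩
  · simp only [List.append_assoc] at e
    obtain ⟨rfl, e₁⟩ := append_inj_of_collapse e ha ha'
    obtain ⟨rfl, rfl⟩ := H.leaf_prefix_unique hl hl' e₁
    obtain ⟨-, rfl, -⟩ := H.entry_unique hl hl'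
    rw [List.append_assoc, hL]
    rfl
  · simp only [List.append_assoc] at e
    obtain ⟨rfl, e₁⟩ := append_inj_of_collapse e ha ha'
    subst e₁
    have := H.leaf_eq_of_append hl (q := γ ++ [l]) (by
      rw [List.append_assoc, hL]
      rfl)
    simp at this
  · exact absurd (prefix_collapse_iff.2 ⟨a, q₀ ++ γ ++ [l], by simp, ha⟩) hb'
  · simp only [List.append_assoc] at e
    obtain ⟨rfl, e₁⟩ := append_inj_of_collapse e ha ha'
    rcases List.eq_nil_or_concat' γ' with rfl | ⟨γ', l', rfl⟩
    · rw [List.append_nil] at e₁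
      subst e₁
      rw [List.append_assoc]
      exact hl'.node
    · rw [← List.append_assoc] at e₁
      obtain ⟨rfl, -⟩ := List.append_inj' e₁ rfl
      exact (H.not_leaf_prefix hl' (by rw [← hK₀, List.append_assoc]) hx).elim
  · simp only [List.append_assoc] at e
    obtain ⟨rfl, e₁⟩ := append_inj_of_collapse e ha ha'
    subst e₁
    rw [List.append_assoc, hL]
    rfl
  · exact absurd (prefix_collapse_iff.2 ⟨a, γ ++ [l], by simp, ha⟩) hb'
  -- The parent is now outside the redex. If its child in the reduct is above the redex, then the
  -- redex node is exactly this child position.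
  all_goals try rw [List.append_assoc] at e
  all_goals try
    obtain ⟨p, rfl, e₂⟩ := exists_redex_above ha' hb e
    have hp : p = [l] := by
      rcases p with _ | ⟨l', p⟩
      · exact absurd (prefix_collapse_iff.2 ⟨_, [], rfl, ha'⟩) (by simpa using hb)
      · simp only [List.cons_append, List.cons.injEq] at e₂
        obtain ⟨rfl, e₂⟩ := e₂
        simp only [List.nil_eq, List.append_eq_nil_iff] at e₂
        rw [e₂.1]
    subst hp
  · exact H.deriv.isSome_of_append ([kk'] ++ γ') (by
      rw [← List.append_assoc, hL]
      rfl)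
  · exact H.deriv.isSome_of_append ([1, 0] ++ γ') (by
      rw [← List.append_assoc, hL]
      rfl)
  · rw [hL]
    rfl

/-- Subject reduction: the reduct is a derivation. -/
theorem isDerivation_reduct (H : Contraction P C T b t t') (ht' : IsTerm001 t')
    (hroot : (reduct P b t' []).isSome) : IsDerivation (reduct P b t') := by
  have hterm : ∀ a J, reduct P b t' a = some J → J.term = sub t' (collapse a) := by
    intro a J hJ
    obtain ⟨α, C', K, hr, hK, rfl⟩ := exists_residual hJ
    rfl
  have hpre : ∀ a q, (reduct P b t' (a ++ q)).isSome → (reduct P b t' a).isSome := by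
    intro a q hq
    induction q using List.reverseRecOn with
    | nil => simpa using hq
    | append_singleton q k ih =>
      rw [← List.append_assoc] at hq
      exact ih (H.reduct_isSome_of_concat hq)
  refine isDerivation_of_quantitative hroot (fun a k => H.reduct_isSome_of_concat) hterm ?_
    H.axForm_reduct H.quantitative_reduct ?_ ?_
  · intro a J hJ
    obtain ⟨α, C', K, hr, hK, rfl⟩ := exists_residual hJ
    refine ⟨ht'.sub ?_, (H.deriv.2.2 _ _ hK).1.2.2⟩
    rcases H.residual_kind hr hK with ⟨j, k, j', -, s, hs, hj⟩ | ⟨-, h⟩ | ⟨-, h⟩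
    · have := hterm _ _ hs
      simp only at this
      rw [this] at hj
      simp only [sub, List.append_nil] at hj
      rw [hj]
      rfl
    · rw [h]
      rfl
    · rw [h]
      rfl
  -- Two such leaves come from leaves of `P` that type a same variable with the same track; these
  -- coincide, and a position has only one residual.
  · intro a q q' i k S S' he he'
    obtain ⟨β, i₀, hβ⟩ := H.exists_origin_of_leaves (hpre a q he.node) i
    obtain ⟨p, C', h1, h2⟩ := hβ q k S he
    obtain ⟨p', C'', h1', h2'⟩ := hβ q' k S' he'
    obtain rfl := H.leaf_unique h1 h1'
    exact List.append_cancel_left (H.residual_functional h2 h2')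
  · intro a J hJ
    obtain ⟨α, C', K, hr, hK, rfl⟩ := exists_residual hJ
    have hchild : ∀ l, P (α ++ [l]) = none → reduct P b t' (a ++ [l]) = none := by
      intro l hl
      rw [← Option.not_isSome_iff_eq_none]
      intro hc
      have := H.isSome_of_reduct_child hr hc
      simp [hl] at this
    have hlab : sub t' (collapse a) [] = t' (collapse a) := by
      simp [sub]
    simp only [hlab]
    rcases H.residual_kind hr hK with ⟨j, k, j', ⟨s', hs', hj⟩, s, hs, hj'⟩ | ⟨h, h'⟩ | ⟨h, h'⟩
    · left
      refine ⟨⟨j', ?_⟩, fun l => hchild l (H.deriv.no_child_of_var hs' hj l)⟩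
      have := hterm _ _ hs
      simp only at this
      rwa [this, hlab] at hj'
    · right; left
      obtain ⟨h0, -, J₀, hJ₀, -, -, hty⟩ := H.deriv.absRule hK h
      obtain ⟨K', hK', hty', hc⟩ := H.reduct_child hr hK hJ₀
      exact ⟨h', fun l hl => hchild l (h0 l hl), K', hK', by rw [hc rfl, hty', hty]⟩
    · right; right
      obtain ⟨h0, -, ⟨J₁, hJ₁, -, hty⟩, -⟩ := H.deriv.appRule hK h
      obtain ⟨K', hK', hty', -⟩ := H.reduct_child hr hK hJ₁
      refine ⟨h', hchild 0 h0, K', hK', ?_⟩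
      rw [hty', hty]
      congr 1
      refine argTypes_congr fun l _ => ?_
      rcases hl : P (α ++ [l]) with _ | L
      · rw [hchild l hl]
      · obtain ⟨L', hL', hty, -⟩ := H.reduct_child hr hK hl
        rw [hL', Option.map_some, Option.map_some, hty]

/-- Subject reduction. -/
theorem proves_reduct (H : Contraction P C T b t t') (ht' : IsTerm001 t') :
    Proves (reduct P b t') C t' T := by
  have hroot : ∃ K', reduct P b t' [] = some K' ∧ K'.ty = T ∧ K'.ctx = C := by
    by_cases hb : b <+: collapse []
    · rw [collapse_nil, List.prefix_nil] at hb
      exact H.reduct_redex (a := []) hb.symm H.proves.2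
    · exact H.reduct_out hb H.proves.2
  obtain ⟨K', hK', rfl, rfl⟩ := hroot
  refine ⟨H.isDerivation_reduct ht' (by rw [hK']; rfl), ?_⟩
  rw [hK']
  obtain ⟨α, C', K, hr, hK, rfl⟩ := exists_residual hK'
  rfl

end Contraction

/-! ### Successive reducts and their limit -/

theorem reducts_succ_of_lt {len : ℕ∞} {t : ℕ → Tm} {b : ℕ → Pos} {P : JTree} {n : ℕ}
    (h : (n : ℕ∞) < len) :
    reducts len t b P (n + 1) = reduct (reducts len t b P n) (b n) (t (n + 1)) := by
  rw [reducts, if_pos h]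

theorem reducts_succ_of_le {len : ℕ∞} {t : ℕ → Tm} {b : ℕ → Pos} {P : JTree} {n : ℕ}
    (h : ¬ (n : ℕ∞) < len) : reducts len t b P (n + 1) = reducts len t b P n := by
  rw [reducts, if_neg h]

theorem ctxTy_reducts_stable {len : ℕ∞} {t : ℕ → Tm} {b : ℕ → Pos} {P : JTree} {a : Pos} {N : ℕ}
    (h : ∀ n, N ≤ n → (n : ℕ∞) < len → a.length < (b n).length) {n : ℕ} (hn : N ≤ n) :
    ctxTy (reducts len t b P n) a = ctxTy (reducts len t b P N) a := by
  induction n, hn using Nat.le_induction with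
  | base => rfl
  | succ n hn ih =>
    by_cases hlt : (n : ℕ∞) < len
    · rw [reducts_succ_of_lt hlt, reduct_of_not_prefix, ih]
      intro hp
      have h1 := hp.length_le
      have h2 := h n hn hlt
      rw [length_collapse] at h1
      omega
    · rw [reducts_succ_of_le hlt, ih]

theorem limitTree_eq {Q : ℕ → JTree} {t' : Tm} {a : Pos} {v : Option (Ctx × TyTree)}
    (h : ∀ᶠ n in Filter.atTop, ctxTy (Q n) a = v) :
    limitTree Q t' a = v.map (fun v => ⟨v.1, sub t' (collapse a), v.2⟩) := by
  unfold limitTree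
  congr 1
  rcases v with _ | v
  · refine pick_eq_none fun w hw => ?_
    obtain ⟨n, h1, h2⟩ := (h.and hw).exists
    rw [h1] at h2
    cases h2
  · refine (pick_eq_some_iff fun u w hu hw => ?_).2 h
    obtain ⟨n, h1, h2⟩ := (hu.and hw).exists
    rw [h1] at h2
    exact Option.some_inj.1 h2

theorem ctxTy_limitTree {Q : ℕ → JTree} {t' : Tm} {a : Pos} {v : Option (Ctx × TyTree)}
    (h : ∀ᶠ n in Filter.atTop, ctxTy (Q n) a = v) : ctxTy (limitTree Q t') a = v := by
  rw [ctxTy, limitTree_eq h]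
  rcases v with _ | v <;> rfl

theorem ctxTy_limitTree_reducts {len : ℕ∞} {t : ℕ → Tm} {b : ℕ → Pos} {t' : Tm} {P : JTree}
    {a : Pos} {N : ℕ} (h : ∀ n, N ≤ n → (n : ℕ∞) < len → a.length < (b n).length) {n : ℕ}
    (hn : N ≤ n) :
    ctxTy (reducts len t b P n) a = ctxTy (limitTree (reducts len t b P) t') a := by
  rw [ctxTy_limitTree (v := ctxTy (reducts len t b P N) a), ctxTy_reducts_stable h hn]
  filter_upwards [Filter.eventually_ge_atTop N] with n hn using ctxTy_reducts_stable h hn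

theorem appDepth_le_length (a : Pos) : appDepth a ≤ a.length := List.countP_le_length

theorem appDepth_le_of_prefix {a c : Pos} (h : a <+: c) : appDepth a ≤ appDepth c :=
  h.sublist.countP_le

namespace StronglyConverges

variable {len : ℕ∞} {t : ℕ → Tm} {b : ℕ → Pos} {t' : Tm}

theorem exists_appDepth (ht : StronglyConverges len t b t') (m : ℕ) :
    ∃ N, ∀ n : ℕ, N ≤ n → (n : ℕ∞) < len → m < appDepth (b n) := by
  by_cases h : len = ⊤
  · obtain ⟨N, hN⟩ := Filter.eventually_atTop.1 ((ht.depth h).eventually_gt_atTop m)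
    exact ⟨N, fun n hn _ => hN n hn⟩
  · obtain ⟨N, rfl⟩ := ENat.ne_top_iff_exists.1 h
    -- For a finite sequence, no step is left from its length onwards.
    refine ⟨N, fun n hn hlt => ?_⟩
    have : n < N := by exact_mod_cast hlt
    omega

theorem exists_length (ht : StronglyConverges len t b t') (m : ℕ) :
    ∃ N, ∀ n : ℕ, N ≤ n → (n : ℕ∞) < len → m < (b n).length := by
  obtain ⟨N, hN⟩ := ht.exists_appDepth m
  exact ⟨N, fun n hn h => (hN n hn h).trans_le (appDepth_le_length _)⟩

theorem eq_limit (ht : StronglyConverges len t b t') {N : ℕ} {p : Pos}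
    (h : ∀ n : ℕ, N ≤ n → (n : ℕ∞) < len → ¬ b n <+: p) : t N p = t' p := by
  have key : ∀ n, N ≤ n → t n p = t N p := by
    intro n hn
    induction n, hn using Nat.le_induction with
    | base => rfl
    | succ n hn ih =>
      by_cases hlt : (n : ℕ∞) < len
      · rw [(ht.step n hlt).eq_of_not_prefix (h n hn hlt), ih]
      · rw [ht.stay n (not_lt.1 hlt), ih]
  obtain ⟨n, h1, h2⟩ := ((ht.limit p).and (Filter.eventually_ge_atTop N)).exists
  rw [← key n h2, h1]

/-- A branch with finitely many argument tracks has bounded applicative depth. From some step on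
every redex is deeper than that, so it never lies on the branch, which is then already a branch of a
term of the sequence. -/
theorem limit_isTerm001 (ht : StronglyConverges len t b t') : IsTerm001 t' := by
  refine ⟨⟨?_, fun p k => ?_⟩, fun f hf => ?_⟩
  · obtain ⟨n, hn⟩ := (ht.limit []).exists
    rw [← hn]
    exact (ht.terms n).1.1
  · obtain ⟨n, h1, h2⟩ := ((ht.limit p).and (ht.limit (p ++ [k]))).exists
    rw [← h1, ← h2]
    exact (ht.terms n).1.2 p k
  · intro hfin
    obtain ⟨N, hN⟩ := ht.exists_appDepth hfin.toFinset.card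
    have hd : ∀ n, appDepth ((List.range n).map f) ≤ hfin.toFinset.card := by
      intro n
      rw [appDepth, List.countP_map, List.countP_eq_length_filter,
        ← List.toFinset_card_of_nodup (List.nodup_range.filter _)]
      refine Finset.card_le_card fun i hi => ?_
      simp only [List.toFinset_filter, Finset.mem_filter, Function.comp_apply,
        decide_eq_true_eq] at hi
      simpa using hi.2
    refine (ht.terms N).2 f (fun n => ?_) hfin
    rw [ht.eq_limit]
    · exact hf n
    · intro m hm hlt hp
      have h1 := hN m hm hlt
      have h2 := (appDepth_le_of_prefix hp).trans (hd n)
      omega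

theorem reducts_spec (ht : StronglyConverges len t b t') {P : JTree} {C : Ctx} {T : TyTree}
    (hP : Proves P C (t 0) T) (hquant : Quantitative P) (n : ℕ) :
    Proves (reducts len t b P n) C (t n) T ∧ Quantitative (reducts len t b P n) := by
  induction n with
  | zero => exact ⟨hP, hquant⟩
  | succ n ih =>
    by_cases h : (n : ℕ∞) < len
    · have H : Contraction (reducts len t b P n) C T (b n) (t n) (t (n + 1)) :=
        ⟨ih.1, ih.2, ht.step n h, (ht.terms n).1⟩
      rw [reducts_succ_of_lt h]
      exact ⟨H.proves_reduct (ht.terms _), H.quantitative_reduct⟩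
    · rw [reducts_succ_of_le h, ht.stay n (not_lt.1 h)]
      exact ih

theorem contraction (ht : StronglyConverges len t b t') {P : JTree} {C : Ctx} {T : TyTree}
    (hP : Proves P C (t 0) T) (hquant : Quantitative P) {n : ℕ} (h : (n : ℕ∞) < len) :
    Contraction (reducts len t b P n) C T (b n) (t n) (t (n + 1)) :=
  ⟨(ht.reducts_spec hP hquant n).1, (ht.reducts_spec hP hquant n).2, ht.step n h,
    (ht.terms n).1⟩

end StronglyConverges

/-! ### Locality of derivations -/

theorem ctxTy_eq_some {P : JTree} {a : Pos} {v : Ctx × TyTree} :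
    ctxTy P a = some v ↔ ∃ s, P a = some ⟨v.1, s, v.2⟩ := by
  unfold ctxTy
  rcases P a with _ | ⟨c, s, T⟩
  · simp
  · constructor
    · intro h
      simp only [Option.map_some, Option.some_inj] at h
      subst h
      exact ⟨s, rfl⟩
    · rintro ⟨s, h⟩
      rw [h]
      rfl

theorem ctxTy_eq_none {P : JTree} {a : Pos} : ctxTy P a = none ↔ P a = none := by
  simp [ctxTy]

theorem ctxTy_map_eq {P R : JTree} {a : Pos} (h : ctxTy P a = ctxTy R a) {J : Judgment}
    (hJ : P a = some J) : ∃ K, R a = some K ∧ K.ctx = J.ctx ∧ K.ty = J.ty := by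
  have : ctxTy R a = some (J.ctx, J.ty) := by
    rw [← h]
    simp [ctxTy, hJ]
  obtain ⟨s, hs⟩ := ctxTy_eq_some.1 this
  exact ⟨_, hs, rfl, rfl⟩

theorem ctxTy_none {P R : JTree} {a : Pos} (h : ctxTy P a = ctxTy R a) (hP : P a = none) :
    R a = none := by
  rwa [← ctxTy_eq_none, ← h, ctxTy_eq_none]

theorem ctxAt_congr {P R : JTree} {a : Pos} (h : ctxTy P a = ctxTy R a) :
    ctxAt P a = ctxAt R a := by
  rcases hP : P a with _ | J
  · rw [ctxAt_of_none hP, ctxAt_of_none (ctxTy_none h hP)]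
  · obtain ⟨K, hK, hc, -⟩ := ctxTy_map_eq h hP
    rw [ctxAt_of_eq hP, ctxAt_of_eq hK, hc]

/-- A labelled tree which agrees locally with derivations, up to the deeper parts of the terms,
is a derivation. -/
theorem isDerivation_of_local {L : JTree} {t' : Tm} (ht' : IsTerm001 t')
    (hterm : ∀ a J, L a = some J → J.term = sub t' (collapse a))
    (h : ∀ a : Pos, ∃ R C t T, Proves R C t T ∧ t (collapse a) = t' (collapse a) ∧
      ∀ p : Pos, p.length ≤ a.length + 1 → ctxTy R p = ctxTy L p) : IsDerivation L := by
  refine ⟨?_, ?_, ?_⟩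
  · obtain ⟨R, C, t, T, hR, -, hL⟩ := h []
    obtain ⟨K, hK, -⟩ := ctxTy_map_eq (hL [] (by simp)) hR.2
    rw [hK]
    rfl
  · intro a k hk
    obtain ⟨R, C, t, T, hR, -, hL⟩ := h a
    obtain ⟨J, hJ⟩ := Option.isSome_iff_exists.1 hk
    obtain ⟨K, hK, -⟩ := ctxTy_map_eq (hL (a ++ [k]) (by simp)).symm hJ
    obtain ⟨K, hK⟩ := Option.isSome_iff_exists.1 (hR.1.2.1 a k (by rw [hK]; rfl))
    obtain ⟨J, hJ, -⟩ := ctxTy_map_eq (hL a (by simp)) hK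
    rw [hJ]
    rfl
  · intro a J hJ
    obtain ⟨R, C, t, T, hR, hlab, hL⟩ := h a
    have hL' : ∀ l, ctxTy R (a ++ [l]) = ctxTy L (a ++ [l]) := fun l => hL _ (by simp)
    obtain ⟨K, hK, hctx, hty⟩ := ctxTy_map_eq (hL a (by simp)).symm hJ
    have hw := hR.1.2.2 a K hK
    have hl : J.term [] = K.term [] := by
      rw [hR.label_eq hK, hterm a J hJ, hlab]
      simp [sub]
    have hs : ∀ {l J'}, L (a ++ [l]) = some J' → J'.term = sub J.term [min l 2] := by
      intro l J' hJ'
      rw [hterm _ _ hJ', hterm _ _ hJ]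
      funext p
      simp [sub]
    have harg : argTypes R a = argTypes L a := argTypes_congr fun l _ => by
      have := congrArg (Option.map Prod.snd) (hL' l)
      simpa [ctxTy, Function.comp_def] using this
    refine ⟨⟨fun i => ?_, ?_, ?_⟩, ?_⟩
    · rw [← hctx]
      exact hw.1.1 i
    · rw [hterm a J hJ]
      refine ht'.sub ?_
      rw [← hlab, ← hR.label_eq hK]
      exact hw.1.2.1.1.1
    · rw [← hty]
      exact hw.1.2.2
    · rcases hw.2 with ⟨h0, i, k, h1, h2, h3⟩ | ⟨h0, h1, J₀, hJ₀, -, h2, h3⟩ |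
        ⟨h0, h1, ⟨J₁, hJ₁, -, h2⟩, -, h3⟩
      · refine Or.inl ⟨fun l => ctxTy_none (hL' l) (h0 l), i, k, by rw [hl, h1], h2, ?_⟩
        rw [← hctx, ← hty, h3]
      · obtain ⟨J₀', hJ₀', hc, ht⟩ := ctxTy_map_eq (hL' 0) hJ₀
        refine Or.inr (Or.inl ⟨fun l hl => ctxTy_none (hL' l) (h0 l hl), by rw [hl, h1], J₀',
          hJ₀', by simpa using hs hJ₀', ?_, ?_⟩)
        · rw [← hctx, h2, hc]
        · rw [← hty, h3, hc, ht]
      · obtain ⟨J₁', hJ₁', -, ht⟩ := ctxTy_map_eq (hL' 1) hJ₁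
        refine Or.inr (Or.inr ⟨ctxTy_none (hL' 0) h0, by rw [hl, h1], ⟨J₁', hJ₁',
          by simpa using hs hJ₁', ?_⟩, ?_, ?_⟩)
        · rw [ht, h2, harg, hty]
        · intro k J' hk hJ'
          simpa [hk] using hs hJ'
        · intro i
          have e : (fun l : ℕ => ctxAt L (a ++ [l]) i) = fun l : ℕ => ctxAt R (a ++ [l]) i :=
            funext fun l => by rw [ctxAt_congr (hL' l)]
          rw [e, ← hctx]
          exact h3 i

theorem limitTree_term {Q : ℕ → JTree} {t' : Tm} {a : Pos} {J : Judgment}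
    (h : limitTree Q t' a = some J) : J.term = sub t' (collapse a) := by
  obtain ⟨v, -, rfl⟩ := Option.map_eq_some_iff.1 h
  rfl

/-- Infinitary subject reduction. -/
theorem StronglyConverges.proves_limitTree {len : ℕ∞} {t : ℕ → Tm} {b : ℕ → Pos} {t' : Tm}
    (ht : StronglyConverges len t b t') {P : JTree} {C : Ctx} {T : TyTree}
    (hP : Proves P C (t 0) T) (hquant : Quantitative P) :
    Proves (limitTree (reducts len t b P) t') C t' T := by
  refine ⟨isDerivation_of_local ht.limit_isTerm001 (fun a J => limitTree_term) fun a => ?_, ?_⟩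
  -- The rule at `a` also involves its premises, which are one track longer.
  · obtain ⟨N, hN⟩ := ht.exists_length (a.length + 1)
    refine ⟨_, _, _, _, (ht.reducts_spec hP hquant N).1, ht.eq_limit fun n hn hlt hp => ?_,
      fun p hp => ctxTy_limitTree_reducts (fun n hn hlt => ?_) le_rfl⟩
    · have h1 := hN n hn hlt
      have h2 := hp.length_le
      rw [length_collapse] at h2
      omega
    · exact hp.trans_lt (hN n hn hlt)
  · obtain ⟨N, hN⟩ := ht.exists_length 0
    have h1 := ctxTy_limitTree_reducts (t := t) (t' := t') (P := P) (a := []) hN le_rfl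
    obtain ⟨K, hK, rfl, rfl⟩ := ctxTy_map_eq h1 (ht.reducts_spec hP hquant N).1.2
    rw [hK]
    congr 1
    have := limitTree_term hK
    cases K
    simp only at this
    subst this
    rfl

/-! ### Finite derivations -/

/-- A derivation of finite depth is quantitative. -/
theorem IsDerivation.quantitative_of_bounded {Q : JTree} (hQ : IsDerivation Q) {M : ℕ}
    (hM : ∀ a, (Q a).isSome → a.length < M) : Quantitative Q := by
  have hax := hQ.axForm
  rw [quantitative_iff hax]
  -- The induction goes from the top of the derivation down, `m` bounding the height left above `a`.
  -- Without a bound, a track could be passed from premise to premise forever without reaching a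
  -- leaf.
  suffices h : ∀ m a J, M ≤ a.length + m → Q a = some J → ∀ i c v, J.ctx i c = some v ↔
      ∃ q k T, Entry Q (a ++ q) (i + binders q) k T ∧ single k T c = some v from
    fun a J hJ => h M a J (by omega) hJ
  intro m
  induction m with
  | zero =>
    intro a J ha hJ
    have := hM a (by rw [hJ]; rfl)
    omega
  | succ m ih =>
    intro a J ha hJ i c v
    have ih' : ∀ l K, Q (a ++ [l]) = some K → ∀ i c v, K.ctx i c = some v ↔
        ∃ q k T, Entry Q (a ++ [l] ++ q) (i + binders q) k T ∧ single k T c = some v :=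
      fun l K hK => ih _ K (by simp; omega) hK
    have hnil : ∀ j k T, Entry Q (a ++ []) j k T → J.term [] = some (.var j) := by
      rintro j k T ⟨s, hs, hj⟩
      rw [List.append_nil, hJ, Option.some_inj] at hs
      rw [hs]
      exact hj
    have hcons : ∀ l q j k T, Entry Q (a ++ l :: q) j k T → (Q (a ++ [l])).isSome :=
      fun l q j k T he => hQ.isSome_of_append q (by simpa using he.node)
    rcases (hQ.2.2 a J hJ).2 with ⟨h0, i', k, h1, h2, h3⟩ | ⟨h0, h1, J₀, hJ₀, -, h2, -⟩ |
      ⟨h0, h1, -, -, h2⟩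
    · have h3' : J.ctx = axCtx i' k J.ty := h3
      have he : Entry Q a i' k J.ty := ⟨J.term, by rw [hJ, ← h3'], h1⟩
      rw [h3]
      constructor
      · intro h
        simp only at h
        split_ifs at h with hi
        · subst hi
          exact ⟨[], k, J.ty, by simpa using he, h⟩
        · simp [emptyTree] at h
      · rintro ⟨q, k', T, he', hs⟩
        rcases q with _ | ⟨l, q⟩
        · obtain ⟨rfl, rfl, rfl⟩ := he.unique hax (by simpa using he')
          simpa using hs
        · have := hcons _ _ _ _ _ he'
          simp [h0 l] at this
    · rw [h2]
      simp only
      rw [ih' 0 J₀ hJ₀]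
      constructor
      · rintro ⟨q, k, T, he, hs⟩
        exact ⟨0 :: q, k, T, by simpa [Nat.add_assoc, Nat.add_comm] using he, hs⟩
      · rintro ⟨q, k, T, he, hs⟩
        rcases q with _ | ⟨l, q⟩
        · have := (hnil _ _ _ he).symm.trans h1
          simp at this
        · have hl : l = 0 := by
            by_contra hl
            have := hcons _ _ _ _ _ he
            simp [h0 l hl] at this
          subst hl
          exact ⟨q, k, T, by simpa [Nat.add_assoc, Nat.add_comm] using he, hs⟩
    · rw [(h2 i).2, join_eq_some]
      · constructor
        · rintro ⟨l, h⟩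
          obtain ⟨K, hK, h⟩ := ctxAt_eq_some.1 h
          have hl : l ≠ 0 := by
            rintro rfl
            simp [h0] at hK
          obtain ⟨q, k, T, he, hs⟩ := (ih' l K hK i c v).1 h
          exact ⟨l :: q, k, T, by simpa [binders_cons_of_ne hl] using he, hs⟩
        · rintro ⟨q, k, T, he, hs⟩
          rcases q with _ | ⟨l, q⟩
          · have := (hnil _ _ _ he).symm.trans h1
            simp at this
          · have hl' := hcons _ _ _ _ _ he
            have hl : l ≠ 0 := by
              rintro rfl
              simp [h0] at hl'
            obtain ⟨K, hK⟩ := Option.isSome_iff_exists.1 hl'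
            exact ⟨l, ctxAt_eq_some.2 ⟨K, hK, (ih' l K hK i c v).2 ⟨q, k, T,
              by simpa [binders_cons_of_ne hl] using he, hs⟩⟩⟩
      · intro l l' u w h h'
        have hroot : ∀ l u, ctxAt Q (a ++ [l]) i c = some u → ∃ k c', c = k :: c' ∧
            k ∈ roots (ctxAt Q (a ++ [l]) i) := by
          intro l u h
          obtain ⟨K, hK, hc⟩ := ctxAt_eq_some.1 h
          obtain ⟨q, k, T, he, hs⟩ := (ih' l K hK i c u).1 hc
          obtain ⟨c', hc', -⟩ := single_eq_some.1 hs
          obtain ⟨v, hv⟩ := Option.isSome_iff_exists.1 (he.isSome hax)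
          refine ⟨k, c', hc', ?_⟩
          rw [ctxAt_of_eq hK]
          exact Option.isSome_iff_exists.2 ⟨v, (ih' l K hK i [k] v).2 ⟨q, k, T, he, by
            rw [single_self]
            exact hv⟩⟩
        obtain ⟨k, c', hc, hk⟩ := hroot l u h
        obtain ⟨k', c'', hc', hk'⟩ := hroot l' w h'
        rw [hc, List.cons.injEq] at hc'
        obtain ⟨rfl, -⟩ := hc'
        have : l = l' := by
          by_contra hne
          exact Set.disjoint_left.1 ((h2 i).1 l l' hne) hk hk'
        subst this
        rw [h] at h'
        exact Option.some_inj.1 h'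

/-- The positions of a labelled tree. -/
def supp (P : JTree) : Set Pos := {a | (P a).isSome}

theorem mem_supp {P : JTree} {a : Pos} : a ∈ supp P ↔ (P a).isSome := Iff.rfl

/-- The prefixes of `a` are `a.length + 1` distinct nodes. -/
theorem IsDerivation.length_lt_ncard {Q : JTree} (hQ : IsDerivation Q) (hf : (supp Q).Finite)
    {a : Pos} (ha : (Q a).isSome) : a.length < (supp Q).ncard := by
  have hsub : (fun i => a.take i) '' ↑(Finset.range (a.length + 1)) ⊆ supp Q := by
    rintro _ ⟨i, -, rfl⟩
    exact hQ.isSome_of_append (a.drop i) (by simpa using ha)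
  have hinj : Set.InjOn (fun i => a.take i) (Finset.range (a.length + 1) : Set ℕ) := by
    intro i hi j hj h
    have := congrArg List.length h
    simp only [List.length_take, Finset.coe_range, Set.mem_Iio] at this hi hj
    omega
  have h1 := Set.ncard_le_ncard hsub hf
  rwa [hinj.ncard_image, Set.ncard_coe_finset, Finset.card_range] at h1

theorem IsDerivation.symbolAt_right_isSome {P : JTree} (hP : IsDerivation P) {a : Pos} :
    (symbolAt P (.right a [])).isSome ↔ (P a).isSome := by
  rcases h : P a with _ | J
  · simp [symbolAt, h]
  · simpa [symbolAt, h] using (hP.2.2 a J h).1.2.2.1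

theorem IsDerivation.finite_supp {Q : JTree} (hQ : IsDerivation Q) (hf : (bisupp Q).Finite) :
    (supp Q).Finite := by
  refine Set.Finite.of_finite_image (f := fun a => BiPos.right a []) (hf.subset ?_) ?_
  · rintro _ ⟨a, ha, rfl⟩
    exact hQ.symbolAt_right_isSome.2 ha
  · intro a _ a' _ h
    simpa using h

/-- The support of each type is finite. -/
def FiniteTypes (P : JTree) : Prop := ∀ a J, P a = some J → {c | (J.ty c).isSome}.Finite

theorem finiteTypes_of_finite_bisupp {Q : JTree} (hf : (bisupp Q).Finite) : FiniteTypes Q := by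
  intro a J hJ
  refine Set.Finite.of_finite_image (f := fun c => BiPos.right a c) (hf.subset ?_) ?_
  · rintro _ ⟨c, hc, rfl⟩
    simpa [bisupp, symbolAt, hJ] using hc
  · intro c _ c' _ h
    simpa using h

/-- There are infinitely many variables, but each left biposition at `a` is due to a leaf above `a`,
and this leaf determines the variable, the track and the type. Pairs of nodes thus bound the left
bipositions. -/
theorem finite_bisupp {Q : JTree} (hQ : IsDerivation Q) (hq : Quantitative Q)
    (hf : (supp Q).Finite) (ht : FiniteTypes Q) : (bisupp Q).Finite := by
  have hax := hQ.axForm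
  let X : Pos → Set BiPos := fun a => {β | ∃ c J, Q a = some J ∧ (J.ty c).isSome ∧ β = .right a c}
  let Y : Pos → Pos → Set BiPos := fun a α => {β | ∃ q i k S c, α = a ++ q ∧
    Entry Q α (i + binders q) k S ∧ (S c).isSome ∧ β = .left a i (k :: c)}
  have hX : ∀ a, (X a).Finite := by
    intro a
    rcases h : Q a with _ | J
    · refine Set.finite_empty.subset ?_
      rintro β ⟨c, J, hJ, -⟩
      simp [h] at hJ
    · refine ((ht a J h).image fun c => BiPos.right a c).subset ?_
      rintro β ⟨c, J', hJ', hc, rfl⟩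
      rw [h, Option.some_inj] at hJ'
      subst hJ'
      exact ⟨c, hc, rfl⟩
  have hY : ∀ a α, (Y a α).Finite := by
    intro a α
    by_cases h : ∃ q i k S, α = a ++ q ∧ Entry Q α (i + binders q) k S
    · obtain ⟨q, i, k, S, rfl, he⟩ := h
      obtain ⟨s, hs, -⟩ := id he
      refine ((ht _ _ hs).image fun c => BiPos.left a i (k :: c)).subset ?_
      rintro β ⟨q', i', k', S', c, e, he', hc, rfl⟩
      obtain rfl := List.append_cancel_left e
      obtain ⟨h1, rfl, rfl⟩ := he.unique hax he'
      obtain rfl : i = i' := by omega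
      exact ⟨c, hc, rfl⟩
    · refine Set.finite_empty.subset ?_
      rintro β ⟨q, i, k, S, c, e, he, -⟩
      exact h ⟨q, i, k, S, e, he⟩
  refine ((hf.biUnion fun a _ => hX a).union
    (hf.biUnion fun a _ => hf.biUnion fun α _ => hY a α)).subset ?_
  rintro (⟨a, c⟩ | ⟨a, i, c⟩) hβ <;> obtain ⟨v, hv⟩ := Option.isSome_iff_exists.1 hβ <;>
    obtain ⟨J, hJ, hv⟩ := Option.bind_eq_some_iff.1 hv
  · left
    exact Set.mem_biUnion (mem_supp.2 (by rw [hJ]; rfl)) ⟨c, J, hJ, by rw [hv]; rfl, rfl⟩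
  · right
    obtain ⟨q, k, S, he, hs⟩ := ((quantitative_iff hax).1 hq a J hJ i c v).1 hv
    obtain ⟨c', rfl, hc'⟩ := single_eq_some.1 hs
    exact Set.mem_biUnion (mem_supp.2 (by rw [hJ]; rfl)) (Set.mem_biUnion (mem_supp.2 he.node)
      ⟨q, i, k, S, c', rfl, he, by rw [hc']; rfl, rfl⟩)

/-! ### Approximations -/

/-- The symbols of `Q` are those of `P`, wherever `Q` has one. -/
def Approx (Q P : JTree) : Prop := ∀ β v, symbolAt Q β = some v → symbolAt P β = some v

theorem IsFiniteApprox.approx {Q P : JTree} (h : IsFiniteApprox Q P) : Approx Q P := by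
  intro β v hv
  rw [← h.2.2.2.2 β (by simp [bisupp, hv]), hv]

theorem Approx.bisupp_subset {Q P : JTree} (h : Approx Q P) : bisupp Q ⊆ bisupp P := by
  intro β hβ
  obtain ⟨v, hv⟩ := Option.isSome_iff_exists.1 hβ
  simp [bisupp, h β v hv]

theorem Approx.node {Q P : JTree} (h : Approx Q P) (hQ : IsDerivation Q) {a : Pos} {J : Judgment}
    (hJ : Q a = some J) : ∃ K, P a = some K ∧ (∀ c v, J.ty c = some v → K.ty c = some v) ∧
      ∀ i c v, J.ctx i c = some v → K.ctx i c = some v := by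
  have h1 := h.bisupp_subset (a := .right a []) (hQ.symbolAt_right_isSome.2 (by rw [hJ]; rfl))
  rcases hK : P a with _ | K
  · simp [bisupp, symbolAt, hK] at h1
  · refine ⟨K, rfl, fun c v hv => ?_, fun i c v hv => ?_⟩
    · simpa [symbolAt, hK] using h (.right a c) v (by simp [symbolAt, hJ, hv])
    · simpa [symbolAt, hK] using h (.left a i c) v (by simp [symbolAt, hJ, hv])

theorem exists_of_left_mem_bisupp {P : JTree} {a c : Pos} {i : ℕ}
    (h : BiPos.left a i c ∈ bisupp P) : ∃ J v, P a = some J ∧ J.ctx i c = some v := by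
  obtain ⟨v, hv⟩ := Option.isSome_iff_exists.1 h
  obtain ⟨J, hJ, hv⟩ := Option.bind_eq_some_iff.1 hv
  exact ⟨J, v, hJ, hv⟩

theorem exists_of_right_mem_bisupp {P : JTree} {a c : Pos}
    (h : BiPos.right a c ∈ bisupp P) : ∃ J v, P a = some J ∧ J.ty c = some v := by
  obtain ⟨v, hv⟩ := Option.isSome_iff_exists.1 h
  obtain ⟨J, hJ, hv⟩ := Option.bind_eq_some_iff.1 hv
  exact ⟨J, v, hJ, hv⟩

theorem left_mem_bisupp {P : JTree} {a c : Pos} {i : ℕ} {J : Judgment} {v : TyLabel}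
    (hJ : P a = some J) (hv : J.ctx i c = some v) : BiPos.left a i c ∈ bisupp P := by
  simp [bisupp, symbolAt, hJ, hv]

theorem right_mem_bisupp {P : JTree} {a c : Pos} {J : Judgment} {v : TyLabel}
    (hJ : P a = some J) (hv : J.ty c = some v) : BiPos.right a c ∈ bisupp P := by
  simp [bisupp, symbolAt, hJ, hv]

/-! ### Monotonicity and continuity of one reduction step -/

namespace Contraction

variable {P Q : JTree} {C D : Ctx} {T U : TyTree} {b : Pos} {t t' : Tm}

/-- Once the term is known, a single biposition witnesses an axiom leaf with a given track. This
transfers leaves between a derivation and its approximations. -/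
theorem entry_of_mem_bisupp (H : Contraction P C T b t t') {α : Pos} {j k : ℕ}
    (hl : t (collapse α) = some (.var j)) (h : BiPos.left α j [k] ∈ bisupp P) :
    ∃ S, Entry P α j k S := by
  obtain ⟨J, v, hJ, hv⟩ := exists_of_left_mem_bisupp h
  obtain ⟨k', -, s, hs, hj⟩ := H.deriv.axForm.entry hJ (by rw [H.label_eq hJ, hl])
  have hs' := hs
  rw [hJ, Option.some_inj] at hs'
  rw [hs'] at hv
  simp only [axCtx_self] at hv
  obtain ⟨c', hc', -⟩ := single_eq_some.1 hv
  simp only [List.cons.injEq] at hc'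
  obtain ⟨rfl, -⟩ := hc'
  exact ⟨_, s, hs, hj⟩

theorem left_mem_bisupp_of_entry (H : Contraction P C T b t t') {α : Pos} {j k : ℕ}
    {S : TyTree} (h : Entry P α j k S) : BiPos.left α j [k] ∈ bisupp P := by
  obtain ⟨v, hv⟩ := Option.isSome_iff_exists.1 (h.isSome H.deriv.axForm)
  obtain ⟨s, hs, -⟩ := h
  exact left_mem_bisupp hs (v := v) (by simpa [single_self] using hv)

/-- Where a node goes depends only on the term, common to both derivations, and on the axiom tracks,
which an approximation shares. -/
theorem residual_mono (H : Contraction P C T b t t') (HQ : Contraction Q D U b t t')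
    (h : Approx Q P) {α α' : Pos} {D' : Ctx} (hr : Residual Q b α α' D') :
    ∃ C', Residual P b α α' C' ∧ ∀ i c v, D' i c = some v → C' i c = some v := by
  rcases HQ.residual_cases hr with ⟨a, q, γ, k, S, J, ha, hl, hJ, rfl, rfl, rfl⟩ |
    ⟨a, γ, J, ha, hJ, hx, rfl, rfl, rfl⟩ | ⟨J, hb, hJ, rfl, rfl⟩ <;>
  obtain ⟨K, hK, -, hc⟩ := h.node HQ.deriv hJ
  · obtain ⟨S', hl'⟩ := H.entry_of_mem_bisupp (hl.label_eq HQ.proves)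
      (h.bisupp_subset (HQ.left_mem_bisupp_of_entry hl))
    refine ⟨_, H.residual_arg ha hl' hK, fun i c v hv => ?_⟩
    unfold liftCtx at hv ⊢
    split_ifs at hv ⊢
    · exact hc _ _ _ hv
    · exact hv
    · exact hc _ _ _ hv
  · refine ⟨_, .body a γ K ha hK (by rwa [H.label_eq hK, ← HQ.label_eq hJ]), fun i c v hv => ?_⟩
    rcases Nat.lt_or_ge i (binders γ) with hi | hi
    · simp only [bodyCtx, if_pos hi] at hv ⊢
      exact hc _ _ _ hv
    · rw [HQ.bodyCtx_eq_some hJ hi] at hv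
      rw [H.bodyCtx_eq_some hK hi]
      rcases hv with hv | ⟨k, hk, hv⟩
      · exact Or.inl (hc _ _ _ hv)
      · obtain ⟨w, hw⟩ := Option.isSome_iff_exists.1 hk
        obtain ⟨L, hL, hv⟩ := ctxAt_eq_some.1 hv
        obtain ⟨L', hL', -, hc'⟩ := h.node HQ.deriv hL
        exact Or.inr ⟨k, Option.isSome_iff_exists.2 ⟨w, hc _ _ _ hw⟩,
          ctxAt_eq_some.2 ⟨L', hL', hc' _ _ _ hv⟩⟩
  · exact ⟨_, .out _ K hb hK, hc⟩

/-- Reduction is monotone. -/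
theorem approx_reduct (H : Contraction P C T b t t') (HQ : Contraction Q D U b t t')
    (h : Approx Q P) : Approx (reduct Q b t') (reduct P b t') := by
  have key : ∀ α' J', reduct Q b t' α' = some J' → ∃ K', reduct P b t' α' = some K' ∧
      (∀ c v, J'.ty c = some v → K'.ty c = some v) ∧
      ∀ i c v, J'.ctx i c = some v → K'.ctx i c = some v := by
    intro α' J' hJ'
    obtain ⟨α, D', J, hr, hJ, rfl⟩ := exists_residual hJ'
    obtain ⟨C', hr', hc⟩ := H.residual_mono HQ h hr
    obtain ⟨K, hK, hty, -⟩ := h.node HQ.deriv hJ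
    exact ⟨_, H.reduct_of_residual hr' hK, hty, hc⟩
  rintro (⟨a, c⟩ | ⟨a, i, c⟩) v hv <;> obtain ⟨J', hJ', hv⟩ := Option.bind_eq_some_iff.1 hv <;>
    obtain ⟨K', hK', hty, hc⟩ := key a J' hJ'
  · simp [symbolAt, hK', hty c v hv]
  · simp [symbolAt, hK', hc i c v hv]

theorem right_nil_mem_bisupp (H : Contraction P C T b t t') {a : Pos} {J : Judgment}
    (hJ : P a = some J) : BiPos.right a [] ∈ bisupp P :=
  H.deriv.symbolAt_right_isSome.2 (by rw [hJ]; rfl)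

/-- A residual in `P` is a residual in the approximations of `P` that contain a suitable finite
part of the bisupport of `P`. -/
theorem exists_finite_residual (H : Contraction P C T b t t') {α α' : Pos} {C' : Ctx}
    (hr : Residual P b α α' C') : ∃ S : Set BiPos, S.Finite ∧ S ⊆ bisupp P ∧
      ∀ Q D U, Contraction Q D U b t t' → S ⊆ bisupp Q → ∃ D', Residual Q b α α' D' := by
  rcases H.residual_cases hr with ⟨a, q, γ, k, S, J, ha, hl, hJ, rfl, rfl, rfl⟩ |
    ⟨a, γ, J, ha, hJ, hx, rfl, rfl, rfl⟩ | ⟨J, hb, hJ, rfl, rfl⟩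
  · refine ⟨{.right (a ++ [k] ++ γ) [], .left (a ++ [1, 0] ++ q) (binders q) [k]},
      Set.toFinite _, ?_, fun Q D U HQ hS => ?_⟩
    · rintro β (rfl | rfl)
      · exact H.right_nil_mem_bisupp hJ
      · exact H.left_mem_bisupp_of_entry hl
    · obtain ⟨K, -, hK, -⟩ := exists_of_right_mem_bisupp (hS (Or.inl rfl))
      obtain ⟨S', hl'⟩ := HQ.entry_of_mem_bisupp (hl.label_eq H.proves) (hS (Or.inr rfl))
      exact ⟨_, HQ.residual_arg ha hl' hK⟩
  · refine ⟨{.right (a ++ [1, 0] ++ γ) []}, Set.toFinite _, ?_, fun Q D U HQ hS => ?_⟩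
    · rintro β rfl
      exact H.right_nil_mem_bisupp hJ
    · obtain ⟨K, -, hK, -⟩ := exists_of_right_mem_bisupp (hS rfl)
      exact ⟨_, .body a γ K ha hK (by rwa [HQ.label_eq hK, ← H.label_eq hJ])⟩
  · refine ⟨{.right α' []}, Set.toFinite _, ?_, fun Q D U HQ hS => ?_⟩
    · rintro β rfl
      exact H.right_nil_mem_bisupp hJ
    · obtain ⟨K, -, hK, -⟩ := exists_of_right_mem_bisupp (hS rfl)
      exact ⟨_, .out α' K hb hK⟩

/-- A symbol of a residual context is copied from one symbol of a context of `P`. At most one more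
biposition is needed, to record the axiom track that brings an argument to its new place. -/
theorem exists_finite_ctx (H : Contraction P C T b t t') {α α' : Pos} {C' : Ctx}
    (hr : Residual P b α α' C') {i : ℕ} {c : Pos} {v : TyLabel} (hv : C' i c = some v) :
    ∃ S : Set BiPos, S.Finite ∧ S ⊆ bisupp P ∧
      ∀ Q D U D', Contraction Q D U b t t' → S ⊆ bisupp Q → Residual Q b α α' D' →
        (D' i c).isSome := by
  rcases H.residual_cases hr with ⟨a, q, γ, k, S, J, ha, hl, hJ, rfl, rfl, rfl⟩ |
    ⟨a, γ, J, ha, hJ, hx, rfl, rfl, rfl⟩ | ⟨J, hb, hJ, rfl, rfl⟩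
  · have hk := hl.two_le H.deriv.axForm
    have h1 : ∃ i₀, J.ctx i₀ c = some v ∧
        ∀ K : Judgment, liftCtx (binders q) (binders γ) K.ctx i = K.ctx i₀ := by
      unfold liftCtx at hv ⊢
      split_ifs at hv ⊢
      · exact ⟨i, hv, fun _ => rfl⟩
      · simp [emptyTree] at hv
      · exact ⟨_, hv, fun _ => rfl⟩
    obtain ⟨i₀, h1, h2⟩ := h1
    refine ⟨{.left (a ++ [k] ++ γ) i₀ c, .left (a ++ [1, 0] ++ q) (binders q) [k]},
      Set.toFinite _, ?_, fun Q D U D' HQ hS hr' => ?_⟩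
    · rintro β (rfl | rfl)
      · exact left_mem_bisupp hJ h1
      · exact H.left_mem_bisupp_of_entry hl
    · obtain ⟨K, w, hK, hw⟩ := exists_of_left_mem_bisupp (hS (Or.inl rfl))
      obtain ⟨S', hl'⟩ := HQ.entry_of_mem_bisupp (hl.label_eq H.proves) (hS (Or.inr rfl))
      obtain ⟨-, rfl⟩ := HQ.residual_unique hr' (HQ.residual_arg ha hl' hK)
      rw [h2, hw]
      rfl
  · have hbody : ∀ {Q D U D' K}, Contraction Q D U b t t' →
        Q (a ++ [1, 0] ++ γ) = some K → Residual Q b (a ++ [1, 0] ++ γ) (a ++ γ) D' →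
        D' = bodyCtx Q a (binders γ) K.ctx := by
      intro Q D U D' K HQ hK hr'
      exact (HQ.residual_unique hr' (.body a γ K ha hK (by
        rwa [HQ.label_eq hK, ← H.label_eq hJ]))).2
    rcases Nat.lt_or_ge i (binders γ) with hi | hi
    · simp only [bodyCtx, if_pos hi] at hv
      refine ⟨{.left (a ++ [1, 0] ++ γ) i c}, Set.toFinite _, ?_, fun Q D U D' HQ hS hr' => ?_⟩
      · rintro β rfl
        exact left_mem_bisupp hJ hv
      · obtain ⟨K, w, hK, hw⟩ := exists_of_left_mem_bisupp (hS rfl)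
        rw [hbody HQ hK hr']
        simp [bodyCtx, hi, hw]
    · rw [H.bodyCtx_eq_some hJ hi] at hv
      rcases hv with hv | ⟨k, hk, hv⟩
      · refine ⟨{.left (a ++ [1, 0] ++ γ) (i + 1) c}, Set.toFinite _, ?_,
          fun Q D U D' HQ hS hr' => ?_⟩
        · rintro β rfl
          exact left_mem_bisupp hJ hv
        · obtain ⟨K, w, hK, hw⟩ := exists_of_left_mem_bisupp (hS rfl)
          rw [hbody HQ hK hr', Option.isSome_iff_exists]
          exact ⟨w, (HQ.bodyCtx_eq_some hK hi).2 (Or.inl hw)⟩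
      · obtain ⟨u, hu⟩ := Option.isSome_iff_exists.1 hk
        obtain ⟨L, hL, hv⟩ := ctxAt_eq_some.1 hv
        refine ⟨{.left (a ++ [1, 0] ++ γ) (binders γ) [k], .left (a ++ [k]) (i - binders γ) c},
          Set.toFinite _, ?_, fun Q D U D' HQ hS hr' => ?_⟩
        · rintro β (rfl | rfl)
          · exact left_mem_bisupp hJ hu
          · exact left_mem_bisupp hL hv
        · obtain ⟨K, w, hK, hw⟩ := exists_of_left_mem_bisupp (hS (Or.inl rfl))
          obtain ⟨L', w', hL', hw'⟩ := exists_of_left_mem_bisupp (hS (Or.inr rfl))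
          rw [hbody HQ hK hr', Option.isSome_iff_exists]
          exact ⟨w', (HQ.bodyCtx_eq_some hK hi).2 (Or.inr ⟨k,
            Option.isSome_iff_exists.2 ⟨w, hw⟩, ctxAt_eq_some.2 ⟨L', hL', hw'⟩⟩)⟩
  · refine ⟨{.left α' i c}, Set.toFinite _, ?_, fun Q D U D' HQ hS hr' => ?_⟩
    · rintro β rfl
      exact left_mem_bisupp hJ hv
    · obtain ⟨K, w, hK, hw⟩ := exists_of_left_mem_bisupp (hS rfl)
      obtain ⟨-, rfl⟩ := HQ.residual_unique hr' (.out α' K hb hK)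
      rw [hw]
      rfl

/-- Each biposition of the reduct depends on a finite part of the bisupport. -/
theorem exists_finite_bisupp (H : Contraction P C T b t t') {β : BiPos}
    (hβ : β ∈ bisupp (reduct P b t')) : ∃ S : Set BiPos, S.Finite ∧ S ⊆ bisupp P ∧
      ∀ Q D U, Contraction Q D U b t t' → S ⊆ bisupp Q → β ∈ bisupp (reduct Q b t') := by
  obtain ⟨a, c⟩ | ⟨a, i, c⟩ := β
  · obtain ⟨J', v, hJ', hv⟩ := exists_of_right_mem_bisupp hβ
    obtain ⟨α, C', J, hr, hJ, rfl⟩ := exists_residual hJ'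
    obtain ⟨S, hf, hS, h⟩ := H.exists_finite_residual hr
    refine ⟨S ∪ {.right α c}, hf.union (Set.toFinite _), ?_, fun Q D U HQ hSQ => ?_⟩
    · rintro β (hβ | rfl)
      · exact hS hβ
      · exact right_mem_bisupp hJ hv
    · obtain ⟨D', hr'⟩ := h Q D U HQ fun β hβ => hSQ (Or.inl hβ)
      obtain ⟨K, w, hK, hw⟩ := exists_of_right_mem_bisupp (hSQ (Or.inr rfl))
      exact right_mem_bisupp (HQ.reduct_of_residual hr' hK) hw
  · obtain ⟨J', v, hJ', hv⟩ := exists_of_left_mem_bisupp hβ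
    obtain ⟨α, C', J, hr, hJ, rfl⟩ := exists_residual hJ'
    obtain ⟨S, hf, hS, h⟩ := H.exists_finite_residual hr
    obtain ⟨S', hf', hS', h'⟩ := H.exists_finite_ctx hr hv
    refine ⟨S ∪ S' ∪ {.right α []}, (hf.union hf').union (Set.toFinite _), ?_,
      fun Q D U HQ hSQ => ?_⟩
    · rintro β ((hβ | hβ) | rfl)
      · exact hS hβ
      · exact hS' hβ
      · exact H.right_nil_mem_bisupp hJ
    · obtain ⟨D', hr'⟩ := h Q D U HQ fun β hβ => hSQ (Or.inl (Or.inl hβ))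
      obtain ⟨w, hw⟩ := Option.isSome_iff_exists.1
        (h' Q D U D' HQ (fun β hβ => hSQ (Or.inl (Or.inr hβ))) hr')
      obtain ⟨K, -, hK, -⟩ := exists_of_right_mem_bisupp (hSQ (Or.inr rfl))
      exact left_mem_bisupp (HQ.reduct_of_residual hr' hK) hw

/-- Sending a node of the reduct to its origin is injective, as an argument derivation is moved to
one leaf and never copied. -/
theorem ncard_supp_reduct (H : Contraction P C T b t t') (hf : (supp P).Finite) :
    (supp (reduct P b t')).Finite ∧ (supp (reduct P b t')).ncard ≤ (supp P).ncard := by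
  have h : ∀ α' ∈ supp (reduct P b t'), ∃ α, α ∈ supp P ∧ ∃ C', Residual P b α α' C' := by
    intro α' hα'
    obtain ⟨J', hJ'⟩ := Option.isSome_iff_exists.1 hα'
    obtain ⟨α, C', J, hr, hJ, -⟩ := exists_residual hJ'
    exact ⟨α, by rw [mem_supp, hJ]; rfl, C', hr⟩
  choose! f hf1 hf2 using h
  have hinj : Set.InjOn f (supp (reduct P b t')) := by
    intro α' hα' β' hβ' e
    obtain ⟨C', h1⟩ := hf2 α' hα'
    obtain ⟨D', h2⟩ := hf2 β' hβ'
    rw [e] at h1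
    exact H.residual_functional h1 h2
  exact ⟨Set.Finite.of_injOn hf1 hinj hf, Set.ncard_le_ncard_of_injOn f hf1 hinj hf⟩

theorem finiteTypes_reduct (h : FiniteTypes P) : FiniteTypes (reduct P b t') := by
  intro a J hJ
  obtain ⟨α, C', K, -, hK, rfl⟩ := exists_residual hJ
  exact h α K hK

end Contraction

/-! ### Approximations along the whole sequence -/

namespace StronglyConverges

variable {len : ℕ∞} {t : ℕ → Tm} {b : ℕ → Pos} {t' : Tm}

theorem approx_reducts (ht : StronglyConverges len t b t') {P Q : JTree} {C D : Ctx}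
    {T U : TyTree} (hP : Proves P C (t 0) T) (hP' : Quantitative P) (hQ : Proves Q D (t 0) U)
    (hQ' : Quantitative Q) (h : Approx Q P) (n : ℕ) :
    Approx (reducts len t b Q n) (reducts len t b P n) := by
  induction n with
  | zero => exact h
  | succ n ih =>
    by_cases hn : (n : ℕ∞) < len
    · rw [reducts_succ_of_lt hn, reducts_succ_of_lt hn]
      exact (ht.contraction hP hP' hn).approx_reduct (ht.contraction hQ hQ' hn) ih
    · rwa [reducts_succ_of_le hn, reducts_succ_of_le hn]

/-- Continuity of one step is iterated backwards: a finite set needs the union of finitely many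
finite sets one step earlier. The set `B₀` is chosen before `Q`, as the choice of an approximation
will depend on it. -/
theorem exists_finite_bisupp_reducts (ht : StronglyConverges len t b t') {P : JTree} {C : Ctx}
    {T : TyTree} (hP : Proves P C (t 0) T) (hP' : Quantitative P) (n : ℕ) :
    ∀ B : Set BiPos, B.Finite → B ⊆ bisupp (reducts len t b P n) →
      ∃ B₀ : Set BiPos, B₀.Finite ∧ B₀ ⊆ bisupp P ∧ ∀ Q D U, Proves Q D (t 0) U →
        Quantitative Q → B₀ ⊆ bisupp Q → B ⊆ bisupp (reducts len t b Q n) := by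
  induction n with
  | zero => exact fun B hB hBP => ⟨B, hB, hBP, fun Q D U _ _ h => h⟩
  | succ n ih =>
    intro B hB hBP
    by_cases hn : (n : ℕ∞) < len
    · rw [reducts_succ_of_lt hn] at hBP
      have h := fun β (hβ : β ∈ B) => (ht.contraction hP hP' hn).exists_finite_bisupp (hBP hβ)
      choose! S hf hS h using h
      obtain ⟨B₀, hB₀, hB₀P, h₀⟩ := ih (⋃ β ∈ B, S β) (hB.biUnion hf)
        (Set.iUnion₂_subset hS)
      refine ⟨B₀, hB₀, hB₀P, fun Q D U hQ hQ' hB₀Q β hβ => ?_⟩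
      rw [reducts_succ_of_lt hn]
      exact h β hβ _ D U (ht.contraction hQ hQ' hn)
        ((Set.subset_biUnion_of_mem hβ).trans (h₀ Q D U hQ hQ' hB₀Q))
    · rw [reducts_succ_of_le hn] at hBP
      simp only [reducts_succ_of_le hn]
      exact ih B hB hBP

theorem finite_reducts (ht : StronglyConverges len t b t') {Q : JTree} {D : Ctx}
    {U : TyTree} (hQ : Proves Q D (t 0) U) (hQ' : Quantitative Q) (hf : (supp Q).Finite)
    (hT : FiniteTypes Q) (n : ℕ) : (supp (reducts len t b Q n)).Finite ∧
      (supp (reducts len t b Q n)).ncard ≤ (supp Q).ncard ∧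
      FiniteTypes (reducts len t b Q n) := by
  induction n with
  | zero => exact ⟨hf, le_rfl, hT⟩
  | succ n ih =>
    by_cases hn : (n : ℕ∞) < len
    · have H := ht.contraction hQ hQ' hn
      obtain ⟨h1, h2⟩ := H.ncard_supp_reduct ih.1
      rw [reducts_succ_of_lt hn]
      exact ⟨h1, h2.trans ih.2.1, Contraction.finiteTypes_reduct ih.2.2⟩
    · rwa [reducts_succ_of_le hn]

end StronglyConverges

/-- The position of a derivation to which a biposition belongs. -/
def BiPos.pos : BiPos → Pos
  | .right a _ => a
  | .left a _ _ => a

theorem symbolAt_congr {P R : JTree} {β : BiPos} (h : ctxTy P β.pos = ctxTy R β.pos) :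
    symbolAt P β = symbolAt R β := by
  have key : ∀ P : JTree, symbolAt P β = (ctxTy P β.pos).bind fun v => match β with
      | .right _ c => v.2 c
      | .left _ i c => v.1 i c := by
    intro P
    rcases β with ⟨a, c⟩ | ⟨a, i, c⟩ <;> rcases hP : P a with _ | J <;>
      simp [symbolAt, ctxTy, BiPos.pos, hP]
  rw [key P, key R, h]

/-- All the reducts have at most as many nodes as `Q`, hence no position as long as this number.
Once the redexes are longer than it, every typed position is frozen, and the limit has no more
symbols than one finite reduct. -/
theorem StronglyConverges.finite_bisupp_limitTree {len : ℕ∞} {t : ℕ → Tm} {b : ℕ → Pos} {t' : Tm}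
    (ht : StronglyConverges len t b t') {Q : JTree} {D : Ctx} {U : TyTree}
    (hQ : Proves Q D (t 0) U) (hQ' : Quantitative Q) (hf : (bisupp Q).Finite) :
    (bisupp (limitTree (reducts len t b Q) t')).Finite := by
  have hfin := ht.finite_reducts hQ hQ' (hQ.1.finite_supp hf) (finiteTypes_of_finite_bisupp hf)
  obtain ⟨N, hN⟩ := ht.exists_length (supp Q).ncard
  have hspec := ht.reducts_spec hQ hQ' N
  refine (finite_bisupp hspec.1.1 hspec.2 (hfin N).1 (hfin N).2.2).subset fun β hβ => ?_
  rw [bisupp, Set.mem_ofPred_eq] at hβ ⊢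
  rw [symbolAt_congr]
  · exact hβ
  by_cases hl : β.pos.length < (supp Q).ncard
  · exact ctxTy_limitTree_reducts (fun n hn hlt => hl.trans (hN n hn hlt)) le_rfl
  · have hnone : ∀ n, ctxTy (reducts len t b Q n) β.pos = none := by
      intro n
      rw [ctxTy_eq_none, ← Option.not_isSome_iff_eq_none]
      intro h
      have := (ht.reducts_spec hQ hQ' n).1.1.length_lt_ncard (hfin n).1 h
      have := (hfin n).2.1
      omega
    rw [hnone, ctxTy_limitTree (Filter.Eventually.of_forall hnone)]

/-- Approximability is preserved by infinitary reduction. -/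
theorem StronglyConverges.approximable_limitTree {len : ℕ∞} {t : ℕ → Tm} {b : ℕ → Pos} {t' : Tm}
    (ht : StronglyConverges len t b t') {P : JTree} {C : Ctx} {T : TyTree}
    (hP : Proves P C (t 0) T) (hP' : Quantitative P) (happ : Approximable P) :
    Approximable (limitTree (reducts len t b P) t') := by
  intro B hB hBP
  -- The finitely many positions involved in `B` have bounded length, so a single `N` freezes them
  -- all, for the reducts of every derivation.
  obtain ⟨m, hm⟩ : ∃ m, ∀ β ∈ B, β.pos.length ≤ m := by
    obtain ⟨m, hm⟩ := (hB.image fun β => β.pos.length).bddAbove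
    exact ⟨m, fun β hβ => hm ⟨β, hβ, rfl⟩⟩
  obtain ⟨N, hN⟩ := ht.exists_length m
  have hstable : ∀ R : JTree, ∀ β ∈ B, symbolAt (reducts len t b R N) β =
      symbolAt (limitTree (reducts len t b R) t') β := fun R β hβ =>
    symbolAt_congr (ctxTy_limitTree_reducts (fun n hn hlt => (hm β hβ).trans_lt (hN n hn hlt))
      le_rfl)
  obtain ⟨B₀, hB₀, hB₀P, h₀⟩ := ht.exists_finite_bisupp_reducts hP hP' N B hB fun β hβ => by
    rw [bisupp, Set.mem_ofPred_eq, hstable P β hβ]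
    exact hBP hβ
  obtain ⟨Q, hQ, hB₀Q⟩ := happ B₀ hB₀ hB₀P
  obtain ⟨J, hJ⟩ := Option.isSome_iff_exists.1 hQ.1.1
  have hpr : Proves Q J.ctx (t 0) J.ty := by
    refine ⟨hQ.1, ?_⟩
    have h1 := hQ.2.1
    rw [hJ, hP.2, Option.map_some, Option.map_some, Option.some_inj] at h1
    have h2 : J.term = t 0 := h1
    rw [hJ, ← h2]
  have hfin := hQ.1.finite_supp hQ.2.2.1
  have hq : Quantitative Q := hQ.1.quantitative_of_bounded
    fun a ha => hQ.1.length_lt_ncard hfin ha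
  have hlim := ht.proves_limitTree hpr hq
  -- Each symbol of either limit can be read in one late reduct, where monotonicity along the
  -- sequence applies.
  have hle : Approx (limitTree (reducts len t b Q) t') (limitTree (reducts len t b P) t') := by
    intro β v hv
    obtain ⟨N', hN'⟩ := ht.exists_length β.pos.length
    rw [← symbolAt_congr (ctxTy_limitTree_reducts hN' le_rfl)] at hv ⊢
    exact ht.approx_reducts hP hP' hpr hq hQ.approx N' β v hv
  refine ⟨_, ⟨hlim.1, ?_, ht.finite_bisupp_limitTree hpr hq hQ.2.2.1, hle.bisupp_subset,
    fun β hβ => ?_⟩, fun β hβ => ?_⟩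
  · rw [hlim.2, (ht.proves_limitTree hP hP').2]
    rfl
  · obtain ⟨v, hv⟩ := Option.isSome_iff_exists.1 hβ
    rw [hv, hle β v hv]
  · rw [bisupp, Set.mem_ofPred_eq, ← hstable Q β hβ]
    exact h₀ Q _ _ hpr hq hB₀Q hβ

end RigidTyping

/-- Infinitary subject reduction, without and with approximability. -/
theorem mainTheorem4 (len : ℕ∞) (t : ℕ → Tm) (b : ℕ → Pos) (t' : Tm)
    (ht : StronglyConverges len t b t')
    (P : JTree) (C : Ctx) (T : TyTree)
    (hP : Proves P C (t 0) T) (hquant : Quantitative P) :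
    -- the successive reducts are derivations
    (∀ n, Proves (reducts len t b P n) C (t n) T) ∧
    -- they stabilize at every position, on the limit tree
    (∀ (a : Pos) (N : ℕ),
      (∀ n, N ≤ n → (n : ℕ∞) < len → a.length < (b n).length) →
      ∀ n, N ≤ n →
        ctxTy (reducts len t b P n) a = ctxTy (limitTree (reducts len t b P) t') a) ∧
    -- the limit tree is a derivation
    Proves (limitTree (reducts len t b P) t') C t' T ∧
    -- approximability is preserved
    (Approximable P → Approximable (limitTree (reducts len t b P) t')) := by
  have hspec := ht.reducts_spec hP hquant
  exact ⟨fun n => (hspec n).1, fun a N h n hn => ctxTy_limitTree_reducts h hn,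
    ht.proves_limitTree hP hquant, ht.approximable_limitTree hP hquant⟩
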